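/- **Setting.** Consider an episodic MDP with state space $\mathcal S$, action space $\mathcal A$, horizon $H\ge 1$, initial law $\mu$, transition kernel $P$ and reward $r:\mathcal S\times\mathcal A\to[0,1]$. Let $\Pi$ be a class of (randomized, time-dependent) policies, and let $\mathcal G$ be a finite set of groups, $|\mathcal G|\ge 2$. A group is a function $g$ from feature vectors to $\{0,1\}$; write $g(s)=g(x(s))$ for the features $x(s)$ of the state $s$. Let $\alpha\in\mathbb R$, $C,\gamma>0$ and $\delta\in(0,1)$. For a distribution $D$ over $\Pi$ and $\lambda\in\mathbb R_{\ge 0}^{\mathcal G}$ put $$V^g(D)=\mathbb E_{\pi\sim D}\,\mathbb E\Big[\sum_{h=0}^{H-1} r(s_h,a_h)g(s_h)\Big],\qquad U(D,\lambda)=\mathbb E_{\pi\sim D,\;h\sim\mathcal U(\{0,\dots,H-1\})}\Big[r(s_h,a_h)+\sum_{g\in\mathcal G}\lambda^g\big(r(s_h,a_h)g(s_h)-\tfrac{\alpha}{H}\big)\Big],$$ where the trajectory $(s_h,a_h)_h$ is generated by $\mu$, $P$ and $\pi$. Let $\Lambda=\{\lambda\in\mathbb R_{\ge0}^{\mathcal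 G}:\|\lambda\|_1\le C\}$ and let $\Lambda_{=}=\{\lambda\in\Lambda:\|\lambda\|_1=C\}$. Let $x_1,\dots,x_d\in\mathcal S$ be the distinct elements of a separator of $\mathcal G$ of size $d$: any two distinct groups $g,g'\in\mathcal G$ satisfy $g(x_j)\ne g'(x_j)$ for some $j$. **Algorithm (contextual FTPL).** Let $\rho=\sqrt{\log|\mathcal G|/(T d^{1/2})}$. In each round $t=1,\dots,T$: 1. the learner plays a distribution $D_t$ over $\Pi$, chosen in an arbitrary (possibly randomized) way as a function of everything drawn in earlier rounds; 2. independent noise variables $\eta_1,\dots,\eta_d$ with Laplace density $\frac{\rho}{2}e^{-\rho|z|}$ are drawn afresh, and the regulator selects $$g_t\in\arg\min_{g\in\mathcal G}\ \sum_{i<t}y_i\,g(s_i)+\sum_{j=1}^d\eta_j\,g(x_j);$$ 3. independently of the noise, $(s_t,a_t)$ is the state-action pair at a uniformly random time in $\{0,\dots,H-1\}$ of a trajectory executed under $D_t$, and $y_t=r(s_t,a_t)$ is observed. From $g_t$ the regulator's weights are assigned by one of two rules. Under the one-group rule, $\lambda_t=Ce_{g_t}$. Under the rule with null action, $\lambda_t=Ce_{g_t}$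 if $D_t$ violates the constraint of $g_t$, i.e. $V^{g_t}(D_t)<\alpha$, and $\lambda_t=0$ otherwise. **Lemma (Contextual FTPL regret).** There is a universal constant $K>0$ such that, in every such setting, if $$T\ \ge\ K\left(\frac{C^2d^{3/2}\log|\mathcal G|}{\gamma^2}+\frac{C^2}{\gamma^2}\ln\frac{|\mathcal G|}{\delta}\right),$$ then with probability at least $1-\delta$ all of the following hold. 1. Under the rule with null action, $$\sum_{t=1}^T U(D_t,\lambda_t)-\min_{\lambda\in\Lambda}\sum_{t=1}^T U(D_t,\lambda)\le\gamma T.$$ 2. Under the one-group rule, $$\sum_{t=1}^T U(D_t,\lambda_t)-\min_{\lambda\in\Lambda_{=}}\sum_{t=1}^T U(D_t,\lambda)\le\gamma T.$$ 3. If moreover some group's constraint is not strictly slack on average, i.e. $\frac1T\sum_{t=1}^T V^g(D_t)\le\alpha$ for some $g\in\mathcal G$, then under the one-group rule also $$\sum_{t=1}^T U(D_t,\lambda_t)-\min_{\lambda\in\Lambda}\sum_{t=1}^T U(D_t,\lambda)\le\gamma T.$$ -/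

import Mathlib

open MeasureTheory ProbabilityTheory
open scoped ENNReal

noncomputable section

namespace ContextualFTPL

universe u v w x y

/-- An episodic MDP with horizon `H ≥ 1`, initial law `init`, time-invariant transition kernel
`P` and time-invariant reward `r` with values in `[0, 1]`. -/
structure MDP (S : Type u) (A : Type v) [MeasurableSpace S] [MeasurableSpace A] where
  H : ℕ
  H_pos : 0 < H
  init : Measure S
  init_prob : IsProbabilityMeasure init
  P : Kernel (S × A) S
  P_markov : IsMarkovKernel P
  r : S × A → ℝ
  r_measurable : Measurable r
  r_mem : ∀ z, r z ∈ Set.Icc (0 : ℝ) 1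

/-- A class of (randomized, time-dependent) policies indexed by `Q`: `act h (q, s)` is the law of
the action that policy `q` takes at time `h` in state `s`. A mixed policy is a probability
measure on `Q`. -/
structure PolicyClass (S : Type u) (A : Type v) (Q : Type w)
    [MeasurableSpace S] [MeasurableSpace A] [MeasurableSpace Q] where
  act : ℕ → Kernel (Q × S) A
  act_markov : ∀ h, IsMarkovKernel (act h)

section Game

variable {S : Type u} {A : Type v} {Q : Type w} {X : Type x}
variable [MeasurableSpace S] [MeasurableSpace A] [MeasurableSpace Q]

/-- Law of the state `s_h` under each policy. -/
def stateLaw (M : MDP S A) (Pol : PolicyClass S A Q) : ℕ → Kernel Q S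
  | 0 => Kernel.const Q M.init
  | h + 1 => M.P ∘ₖ (stateLaw M Pol h ⊗ₖ Pol.act h)

/-- Law of the pair `(s_h, a_h)` under each policy. -/
def stepLaw (M : MDP S A) (Pol : PolicyClass S A Q) (h : ℕ) : Kernel Q (S × A) :=
  stateLaw M Pol h ⊗ₖ Pol.act h

/-- Law of `(s_h, a_h)` under each policy when `h` is uniform on `{0, …, H - 1}`. -/
def sampleLaw (M : MDP S A) (Pol : PolicyClass S A Q) : Kernel Q (S × A) where
  toFun q := (M.H : ℝ≥0∞)⁻¹ • ∑ h ∈ Finset.range M.H, stepLaw M Pol h q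
  measurable' := by
    refine Measure.measurable_of_measurable_coe _ fun s hs => ?_
    simp only [Measure.smul_apply, Measure.finsetSum_apply, smul_eq_mul]
    exact (Finset.measurable_sum _ fun h _ => Kernel.measurable_coe _ hs).const_mul _

/-- Membership `g(s) = g(x(s)) ∈ {0, 1}` of the state `s` with features `feat s` in a group. -/
def member (feat : S → X) (g : X → Bool) (s : S) : ℝ := if g (feat s) then 1 else 0

/-- `V^g(D) = E_{π ∼ D} E[∑_{h < H} r(s_h, a_h) g(s_h)]`. -/
def groupValue (M : MDP S A) (Pol : PolicyClass S A Q) (feat : S → X) (g : X → Bool)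
    (D : Measure Q) : ℝ :=
  ∫ q, ∑ h ∈ Finset.range M.H, ∫ z, M.r z * member feat g z.1 ∂(stepLaw M Pol h q) ∂D

/-- The average-reward Lagrangian
`U(D, λ) = E_{π ∼ D, h ∼ U([H])} [r(s_h, a_h) + ∑_g λ^g (r(s_h, a_h) g(s_h) - α / H)]`. -/
def lagrangian (M : MDP S A) (Pol : PolicyClass S A Q) (feat : S → X) (G : Finset (X → Bool))
    (α : ℝ) (D : Measure Q) (lam : G → ℝ) : ℝ :=
  ∫ z, (M.r z + ∑ g : G, lam g * (M.r z * member feat g.1 z.1 - α / M.H))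
    ∂(D.bind (sampleLaw M Pol))

/-- `Λ = {λ ≥ 0 : ‖λ‖₁ ≤ C}`. -/
def weights (G : Finset (X → Bool)) (C : ℝ) : Set (G → ℝ) :=
  {lam | (∀ g, 0 ≤ lam g) ∧ ∑ g, |lam g| ≤ C}

/-- `{λ ≥ 0 : ‖λ‖₁ = C}`, the mixtures of the one-group weights `C e_g`. -/
def fullWeights (G : Finset (X → Bool)) (C : ℝ) : Set (G → ℝ) :=
  {lam | (∀ g, 0 ≤ lam g) ∧ ∑ g, |lam g| = C}

/-- The regulator's regret `∑_t U(D_t, λ_t) - min_{λ ∈ B} ∑_t U(D_t, λ)` against the comparators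
in `B` (the minimum is attained for compact nonempty `B`). -/
def regret (M : MDP S A) (Pol : PolicyClass S A Q) (feat : S → X) (G : Finset (X → Bool))
    (α : ℝ) {T : ℕ} (D : Fin T → Measure Q) (lam : Fin T → G → ℝ) (B : Set (G → ℝ)) : ℝ :=
  ∑ t, lagrangian M Pol feat G α (D t) (lam t) -
    sInf ((fun l => ∑ t, lagrangian M Pol feat G α (D t) l) '' B)

open scoped Classical in
/-- `C e_g`. -/
def oneGroup (G : Finset (X → Bool)) (C : ℝ) (g : G) : G → ℝ := Pi.single g C

open scoped Classical in
/-- `C e_g` if the constraint `V^g(D) ≥ α` of the group `g` is violated by `D`, and `0`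
otherwise. -/
def violatedGroup (M : MDP S A) (Pol : PolicyClass S A Q) (feat : S → X) (G : Finset (X → Bool))
    (α C : ℝ) (D : Measure Q) (g : G) : G → ℝ :=
  if groupValue M Pol feat g.1 D < α then oneGroup G C g else 0

/-- `Z` is a separator for `G`: any two distinct groups disagree on some state in `Z`. -/
def IsSeparator (feat : S → X) (G : Finset (X → Bool)) (Z : Set S) : Prop :=
  ∀ g ∈ G, ∀ g' ∈ G, g ≠ g' → ∃ s ∈ Z, g (feat s) ≠ g' (feat s)

/-- An optimization oracle for `G`: on contexts `s_1, …, s_n` and costs `c_1, …, c_n` it returns a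
minimizer over `g ∈ G` of `∑_i c_i g(s_i)`; ties are broken by an arbitrary measurable rule. -/
structure OptOracle (feat : S → X) (G : Finset (X → Bool)) where
  opt : (n : ℕ) → (Fin n → S) × (Fin n → ℝ) → G
  opt_measurable : ∀ n (g : G), MeasurableSet {p | opt n p = g}
  opt_le : ∀ n (s : Fin n → S) (c : Fin n → ℝ), ∀ g ∈ G,
    ∑ i, c i * member feat (opt n (s, c)).1 (s i) ≤ ∑ i, c i * member feat g (s i)

end Game

section Algorithm

/-- The Laplace distribution with (rate) parameter `ρ`, of density `(ρ / 2) exp (-ρ |z|)`. -/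
def laplace (ρ : ℝ) : Measure ℝ :=
  volume.withDensity fun z => ENNReal.ofReal (ρ / 2 * Real.exp (-ρ * |z|))

/-- The parameter `ρ = √(log |G| / (T d^{1/2}))`. -/
def noiseRate (N d T : ℕ) : ℝ := √(Real.log N / (T * √(d : ℝ)))

/-- What is drawn in one round: the noise `η_{1:d}`, the state `s_t` and the action `a_t`. -/
abbrev Round (S : Type u) (A : Type v) (d : ℕ) : Type (max u v) := (Fin d → ℝ) × S × A

/-- The learner's private random seed and the draws of the first `t` rounds. -/
abbrev History (W : Type y) (S : Type u) (A : Type v) (d t : ℕ) : Type (max y u v) :=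
  W × (Fin t → Round S A d)

/-- An adaptive learner: before round `t` it plays the mixed policy `D_t = play t history`,
a function of its seed and of all the previous draws. -/
structure Learner (W : Type y) (S : Type u) (A : Type v) (Q : Type w) (d : ℕ)
    [MeasurableSpace W] [MeasurableSpace S] [MeasurableSpace A] [MeasurableSpace Q] where
  seed : Measure W
  seed_prob : IsProbabilityMeasure seed
  play : (t : ℕ) → Kernel (History W S A d t) Q
  play_markov : ∀ t, IsMarkovKernel (play t)

variable {S : Type u} {A : Type v} {Q : Type w} {X : Type x} {W : Type y}
variable [MeasurableSpace S] [MeasurableSpace A] [MeasurableSpace Q] [MeasurableSpace W]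
variable {d : ℕ}

/-- Conditional law of round `t` given the history: `η_1, …, η_d` are independent
`Lap(ρ)` variables, and independently `(s_t, a_t)` is the pair at a uniform time of a trajectory
executed under `D_t`. -/
def roundLaw (M : MDP S A) (Pol : PolicyClass S A Q) (L : Learner W S A Q d) (ρ : ℝ) (t : ℕ) :
    Kernel (History W S A d t) (Round S A d) :=
  Kernel.const _ (Measure.pi fun _ : Fin d => laplace ρ) ×ₖ (sampleLaw M Pol ∘ₖ L.play t)

/-- Law of the history of the first `t` rounds. -/
def historyLaw (M : MDP S A) (Pol : PolicyClass S A Q) (L : Learner W S A Q d) (ρ : ℝ) :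
    (t : ℕ) → Measure (History W S A d t)
  | 0 => L.seed.map fun ω => (ω, Fin.elim0)
  | t + 1 => (historyLaw M Pol L ρ t ⊗ₘ roundLaw M Pol L ρ t).map
      fun p => (p.1.1, Fin.snoc p.1.2 p.2)

/-- The history before round `t`. -/
def before {T : ℕ} (ω : History W S A d T) (t : Fin T) : History W S A d t :=
  (ω.1, fun i => ω.2 ⟨i, i.2.trans t.2⟩)

/-- The mixed policy `D_t` played by the learner. -/
def played (L : Learner W S A Q d) {T : ℕ} (ω : History W S A d T) (t : Fin T) : Measure Q :=
  L.play t (before ω t)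

/-- The group `g_t = OPT(s_{1:t-1} ‖ x_{1:d}, y_{1:t-1} ‖ η_{1:d})` selected in round `t`, where
`y_i = r(s_i, a_i)` and `η` is the noise drawn in round `t`. -/
def selected (M : MDP S A) {feat : S → X} {G : Finset (X → Bool)} (O : OptOracle feat G)
    (sep : Fin d → S) {T : ℕ} (ω : History W S A d T) (t : Fin T) : G :=
  O.opt (t + d)
    (Fin.append (fun i => ((before ω t).2 i).2.1) sep,
     Fin.append (fun i => M.r ((before ω t).2 i).2) (ω.2 t).1)

end Algorithm

end ContextualFTPL

end

open MeasureTheory ProbabilityTheory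
open scoped ENNReal

noncomputable section

namespace ContextualFTPL

universe u v w x y

/-! ### The Laplace distribution -/

/-! Write c_g(D) for the mean of r·g at a uniform time (`groupCost`). The Lagrangian is affine in λ
with slopes c_g(D) - α/H, so all three conclusions follow deterministically from one estimate: C ∑_t
(c_{g_t}(D_t) - c_g(D_t)) ≤ γT for every group g (`regret_le_of_groupCost`).

The learner is adaptive, but the noise of round t is fresh and independent of (s_t, a_t) given the
history. Let p_t(s) be the probability over the noise that the group selected in round t contains s
(`coverProb`). Given the history, c_{g_t}(D_t) and y_t p_t(s_t) have the same mean, and so do y_t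
g(s_t) and c_g(D_t). Replacing one by the other costs a martingale with bounded increments, which
Azuma's inequality and a union bound over groups control (`historyLaw_sum_increments_ge_le`). What
remains is ∑_t y_t p_t(s_t) - ∑_t y_t g(s_t). On each path this is the expected regret of follow the
perturbed leader against a fixed loss sequence, since p_t depends on the past only through the
observed data (`sum_reward_mul_coverProb_le`).

That regret (`sum_integral_leader_le`) has two sources. Playing the leader before rather than after
seeing the current loss matters only if the two leaders differ at some separator point, which has
probability at most dρ/2 (`measure_leaders_differ_le`). The perturbation itself costs O(√d log|G| /
ρ), by exponential moments. The chosen ρ balances the two. -/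

lemma laplace_apply_le {ρ : ℝ} (hρ : 0 ≤ ρ) (s : Set ℝ) :
    laplace ρ s ≤ ENNReal.ofReal (ρ / 2) * volume s := by
  have h : laplace ρ ≤ ENNReal.ofReal (ρ / 2) • (volume : Measure ℝ) := by
    rw [← withDensity_const]
    refine withDensity_mono (Filter.Eventually.of_forall fun z => ENNReal.ofReal_le_ofReal ?_)
    have : Real.exp (-ρ * |z|) ≤ 1 := Real.exp_le_one_iff.2 (by nlinarith [abs_nonneg z])
    nlinarith
  simpa using h s

lemma lintegral_exp_laplace {ρ s : ℝ} (h₁ : -ρ < s) (h₂ : s < ρ) :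
    ∫⁻ z, ENNReal.ofReal (Real.exp (s * z)) ∂laplace ρ =
      ENNReal.ofReal (ρ ^ 2 / (ρ ^ 2 - s ^ 2)) := by
  have hρ : 0 < ρ := by linarith
  have hI : IntegrableOn (fun z : ℝ => Real.exp ((ρ + s) * z)) (Set.Iic 0) :=
    integrableOn_exp_mul_Iic (by linarith) 0
  have hJ : IntegrableOn (fun z : ℝ => Real.exp ((s - ρ) * z)) (Set.Ioi 0) :=
    integrableOn_exp_mul_Ioi (by linarith) 0
  rw [laplace, lintegral_withDensity_eq_lintegral_mul _ (by fun_prop) (by fun_prop)]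
  have e₁ : ∫⁻ z in Set.Iic (0 : ℝ), ((fun z => ENNReal.ofReal (ρ / 2 * Real.exp (-ρ * |z|))) *
      fun z => ENNReal.ofReal (Real.exp (s * z))) z = ENNReal.ofReal (ρ / 2 * (1 / (ρ + s))) := by
    rw [show ρ / 2 * (1 / (ρ + s)) = ∫ z in Set.Iic (0 : ℝ), ρ / 2 * Real.exp ((ρ + s) * z) by
      rw [integral_const_mul, integral_exp_mul_Iic (by linarith)]; simp,
      ofReal_integral_eq_lintegral_ofReal (hI.const_mul _)
        (Filter.Eventually.of_forall fun z => by positivity)]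
    refine setLIntegral_congr_fun measurableSet_Iic fun z hz => ?_
    simp only [Pi.mul_apply]
    rw [← ENNReal.ofReal_mul (by positivity), mul_assoc, ← Real.exp_add, abs_of_nonpos hz]
    ring_nf
  have e₂ : ∫⁻ z in Set.Ioi (0 : ℝ), ((fun z => ENNReal.ofReal (ρ / 2 * Real.exp (-ρ * |z|))) *
      fun z => ENNReal.ofReal (Real.exp (s * z))) z = ENNReal.ofReal (ρ / 2 * (1 / (ρ - s))) := by
    rw [show ρ / 2 * (1 / (ρ - s)) = ∫ z in Set.Ioi (0 : ℝ), ρ / 2 * Real.exp ((s - ρ) * z) by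
      rw [integral_const_mul, integral_exp_mul_Ioi (by linarith)]
      rw [mul_zero, Real.exp_zero, ← neg_sub ρ s, neg_div_neg_eq],
      ofReal_integral_eq_lintegral_ofReal (hJ.const_mul _)
        (Filter.Eventually.of_forall fun z => by positivity)]
    refine setLIntegral_congr_fun measurableSet_Ioi fun z hz => ?_
    simp only [Pi.mul_apply]
    rw [← ENNReal.ofReal_mul (by positivity), mul_assoc, ← Real.exp_add, abs_of_pos hz]
    ring_nf
  rw [← lintegral_add_compl _ (measurableSet_Iic (a := (0 : ℝ))), Set.compl_Iic, e₁, e₂,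
    ← ENNReal.ofReal_add]
  · congr 1
    have h₃ : ρ + s ≠ 0 := by linarith
    have h₄ : ρ - s ≠ 0 := by linarith
    rw [show ρ ^ 2 - s ^ 2 = (ρ + s) * (ρ - s) by ring]
    field_simp
    ring
  · have : 0 < ρ + s := by linarith
    positivity
  · have : 0 < ρ - s := by linarith
    positivity

lemma isProbabilityMeasure_laplace {ρ : ℝ} (hρ : 0 < ρ) : IsProbabilityMeasure (laplace ρ) := by
  refine ⟨?_⟩
  have := lintegral_exp_laplace (ρ := ρ) (s := 0) (by linarith) hρ
  simpa [hρ.ne'] using this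

lemma integrable_exp_laplace {ρ s : ℝ} (h₁ : -ρ < s) (h₂ : s < ρ) :
    Integrable (fun z => Real.exp (s * z)) (laplace ρ) := by
  refine ⟨by fun_prop, ?_⟩
  rw [hasFiniteIntegral_iff_ofReal (Filter.Eventually.of_forall fun z => (Real.exp_pos _).le),
    lintegral_exp_laplace h₁ h₂]
  exact ENNReal.ofReal_lt_top

/-- For s² ≤ ρ²/2 the exact value ρ²/(ρ² - s²) is at most 1 + 2s²/ρ²: Laplace noise is sub-Gaussian
for small s. -/
lemma integral_exp_laplace_le {ρ s : ℝ} (hρ : 0 < ρ) (hs : 2 * s ^ 2 ≤ ρ ^ 2) :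
    ∫ z, Real.exp (s * z) ∂laplace ρ ≤ Real.exp (2 * (s ^ 2 / ρ ^ 2)) := by
  have h := abs_lt.1 (abs_lt_of_sq_lt_sq (by nlinarith : s ^ 2 < ρ ^ 2) hρ.le)
  have hpos : 0 < ρ ^ 2 - s ^ 2 := by nlinarith
  rw [integral_eq_lintegral_of_nonneg_ae (Filter.Eventually.of_forall fun z => (Real.exp_pos _).le)
    (by fun_prop), lintegral_exp_laplace h.1 h.2, ENNReal.toReal_ofReal (by positivity)]
  refine le_trans ?_ (Real.add_one_le_exp _)
  rw [div_le_iff₀ hpos]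
  have : s ^ 2 / ρ ^ 2 * ρ ^ 2 = s ^ 2 := div_mul_cancel₀ _ (by positivity)
  have h2 : s ^ 2 / ρ ^ 2 * s ^ 2 ≤ s ^ 2 / 2 := by
    rw [div_mul_eq_mul_div, div_le_iff₀ (by positivity)]; nlinarith [sq_nonneg s]
  nlinarith

/-! ### Follow the perturbed leader on a fixed sequence of losses -/

/-- Fubini in coordinate j: a uniform bound on the one-dimensional slices passes to the product
measure. -/
lemma pi_le_of_forall_update_le {d : ℕ} {μ : Measure ℝ} [IsProbabilityMeasure μ] (j : Fin d)
    {s : Set (Fin d → ℝ)} (hs : MeasurableSet s) {c : ℝ≥0∞}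
    (h : ∀ η : Fin d → ℝ, μ {z | Function.update η j z ∈ s} ≤ c) :
    Measure.pi (fun _ => μ) s ≤ c := by
  obtain ⟨n, rfl⟩ : ∃ n, d = n + 1 := ⟨d - 1, by have := j.2; omega⟩
  have e := (measurePreserving_piFinSuccAbove (fun _ : Fin (n + 1) => μ) j).symm
  rw [← e.measure_preimage hs.nullMeasurableSet,
    Measure.prod_apply_symm (e.measurable hs)]
  refine (lintegral_mono (g := fun _ => c) fun y => ?_).trans (by simp)
  refine le_trans (le_of_eq ?_) (h (Fin.insertNth j 0 y))
  congr 1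
  ext z
  simp [MeasurableEquiv.piFinSuccAbove, Fin.insertNthEquiv]

/-- The perturbation acts as a loss paid before round 0. In the induction, the comparator in the
first T rounds is the leader after T + 1 rounds. -/
lemma be_the_leader {ι : Type*} {ℓ : ℕ → ι → ℝ} {p : ι → ℝ} {m : ℕ → ι}
    (hm : ∀ t g, ∑ i ∈ Finset.range t, ℓ i (m t) + p (m t) ≤
      ∑ i ∈ Finset.range t, ℓ i g + p g) (T : ℕ) (g : ι) :
    p (m 0) + ∑ t ∈ Finset.range T, ℓ t (m (t + 1)) ≤ ∑ t ∈ Finset.range T, ℓ t g + p g := by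
  induction T generalizing g with
  | zero => simpa using hm 0 g
  | succ T ih =>
    have h₁ := ih (m (T + 1))
    have h₂ := hm (T + 1) g
    rw [Finset.sum_range_succ] at h₂ ⊢
    linarith

/-- The perturbation `∑_j η_j g(x_j)` of the cumulative loss of `g`, where `B g j = g(x_j)`. -/
def perturbation {ι : Type*} {d : ℕ} (B : ι → Fin d → Bool) (η : Fin d → ℝ) (g : ι) : ℝ :=
  ∑ j, η j * if B g j then 1 else 0

lemma perturbation_update {ι : Type*} {d : ℕ} (B : ι → Fin d → Bool) (η : Fin d → ℝ) (j : Fin d)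
    (z : ℝ) (g : ι) : perturbation B (Function.update η j z) g =
      (z * if B g j then 1 else 0) + perturbation B (Function.update η j 0) g := by
  have h : ∀ w : ℝ, perturbation B (Function.update η j w) g =
      (w * if B g j then 1 else 0) + ∑ i ∈ Finset.univ.erase j, η i * if B g i then 1 else 0 := by
    intro w
    rw [perturbation, ← Finset.add_sum_erase _ _ (Finset.mem_univ j), Function.update_self]
    congr 1
    refine Finset.sum_congr rfl fun i hi => ?_
    rw [Function.update_of_ne (Finset.ne_of_mem_erase hi)]
  rw [h z, h 0]
  ring

section Stability

variable {ι : Type*} {d : ℕ} {B : ι → Fin d → Bool} {A ℓ : ι → ℝ}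
  {m m' : (Fin d → ℝ) → ι}

/-- With the other coordinates frozen, a leader contains x_j exactly when z lies below a threshold
(up to ties): the best cost among groups avoiding x_j minus the best cost, without z, among groups
containing it. Adding a loss in [0, 1] shifts the threshold by at most 1, and the leaders disagree
at x_j only between the two thresholds. -/
lemma dist_le_of_leaders_differ (hℓ : ∀ g, ℓ g ∈ Set.Icc (0 : ℝ) 1)
    (hm : ∀ η g, A (m η) + perturbation B η (m η) ≤ A g + perturbation B η g)
    (hm' : ∀ η g, A (m' η) + ℓ (m' η) + perturbation B η (m' η) ≤
      A g + ℓ g + perturbation B η g)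
    (η : Fin d → ℝ) (j : Fin d) {z z' : ℝ} (hzz : z < z')
    (hz : B (m (Function.update η j z)) j ≠ B (m' (Function.update η j z)) j)
    (hz' : B (m (Function.update η j z')) j ≠ B (m' (Function.update η j z')) j) :
    z' - z ≤ 1 := by
  have a := fun g => hm (Function.update η j z) g
  have a' := fun g => hm (Function.update η j z') g
  have b := fun g => hm' (Function.update η j z) g
  have b' := fun g => hm' (Function.update η j z') g
  have l := fun g => (hℓ g).1
  have u := fun g => (hℓ g).2
  set g₁ := m (Function.update η j z)
  set g₂ := m (Function.update η j z')
  set g₃ := m' (Function.update η j z)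
  set g₄ := m' (Function.update η j z')
  simp only [perturbation_update B η j z, perturbation_update B η j z'] at a a' b b'
  -- Comparing a leader with itself at z and z' gives monotonicity of its membership in z. Comparing
  -- `m` at one point with `m'` at the other gives z' - z ≤ 1 when the disagreement has the same
  -- orientation at both.
  have := a g₂
  have := a' g₁
  have := b g₄
  have := b' g₃
  have := a g₄
  have := b' g₁
  have := a' g₃
  have := b g₂
  have := l g₁
  have := l g₂
  have := l g₃
  have := l g₄
  have := u g₁
  have := u g₂
  have := u g₃
  have := u g₄
  cases h₁ : B g₁ j <;> cases h₂ : B g₂ j <;> cases h₃ : B g₃ j <;> cases h₄ : B g₄ j <;>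
    simp only [h₁, h₂, h₃, h₄, ne_eq, not_true_eq_false, if_true, if_false, Bool.false_eq_true,
      mul_one, mul_zero] at * <;> linarith

/-- Distinct leaders disagree at a separator point. For each point, the noise values causing this
form slices of diameter at most 1, and the Laplace density is at most ρ/2. -/
lemma measure_leaders_differ_le [MeasurableSpace ι] [MeasurableSingletonClass ι] [Finite ι]
    {ρ : ℝ} (hρ : 0 < ρ) (hℓ : ∀ g, ℓ g ∈ Set.Icc (0 : ℝ) 1)
    (hB : ∀ g g', g ≠ g' → ∃ j, B g j ≠ B g' j) (mm : Measurable m) (mm' : Measurable m')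
    (hm : ∀ η g, A (m η) + perturbation B η (m η) ≤ A g + perturbation B η g)
    (hm' : ∀ η g, A (m' η) + ℓ (m' η) + perturbation B η (m' η) ≤
      A g + ℓ g + perturbation B η g) :
    Measure.pi (fun _ : Fin d => laplace ρ) {η | m η ≠ m' η} ≤ ENNReal.ofReal (d * (ρ / 2)) := by
  have := isProbabilityMeasure_laplace hρ
  have hsub : {η | m η ≠ m' η} ⊆ ⋃ j, {η | B (m η) j ≠ B (m' η) j} := by
    intro η hη
    simpa using hB _ _ hη
  refine (measure_mono hsub).trans ((measure_iUnion_fintype_le _ _).trans ?_)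
  have key : ∀ j, Measure.pi (fun _ : Fin d => laplace ρ) {η | B (m η) j ≠ B (m' η) j} ≤
      ENNReal.ofReal (ρ / 2) := by
    intro j
    have hmeas : MeasurableSet {η | B (m η) j ≠ B (m' η) j} := by
      have h : Measurable fun g : ι => B g j := measurable_of_countable _
      exact (measurableSet_eq_fun (h.comp mm) (h.comp mm')).compl
    refine pi_le_of_forall_update_le j hmeas fun η => (laplace_apply_le hρ.le _).trans ?_
    conv_rhs => rw [← mul_one (ENNReal.ofReal (ρ / 2))]
    gcongr
    refine (Real.volume_le_diam _).trans (le_of_le_of_eq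
      (Metric.ediam_le_of_forall_dist_le (C := 1) fun z hz z' hz' => ?_) ENNReal.ofReal_one)
    rw [Real.dist_eq]
    rcases lt_trichotomy z z' with h | h | h
    · rw [abs_sub_comm, abs_of_pos (sub_pos.2 h)]
      exact dist_le_of_leaders_differ hℓ hm hm' η j h hz hz'
    · simp [h]
    · rw [abs_of_pos (sub_pos.2 h)]
      exact dist_le_of_leaders_differ hℓ hm hm' η j h hz' hz
  refine (Finset.sum_le_sum fun j _ => key j).trans ?_
  rw [Finset.sum_const, Finset.card_univ, Fintype.card_fin, nsmul_eq_mul,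
    ENNReal.ofReal_mul (by positivity), ENNReal.ofReal_natCast]

end Stability

/-- Independence factors the exponential moment over the separator; points outside g contribute a
factor 1. -/
lemma integrable_exp_perturbation {ι : Type*} {d : ℕ} (B : ι → Fin d → Bool) {ρ s : ℝ}
    (hρ : 0 < ρ) (hs : 2 * s ^ 2 ≤ ρ ^ 2) (g : ι) :
    Integrable (fun η => Real.exp (s * perturbation B η g))
        (Measure.pi fun _ : Fin d => laplace ρ) ∧
      ∫ η, Real.exp (s * perturbation B η g) ∂(Measure.pi fun _ : Fin d => laplace ρ) ≤
        Real.exp (d * (2 * (s ^ 2 / ρ ^ 2))) := by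
  have := isProbabilityMeasure_laplace hρ
  have e : (fun η => Real.exp (s * perturbation B η g)) = fun η : Fin d → ℝ =>
      ∏ j, (fun j z => Real.exp ((s * if B g j then 1 else 0) * z)) j (η j) := by
    funext η
    rw [perturbation, Finset.mul_sum, Real.exp_sum]
    refine Finset.prod_congr rfl fun j _ => ?_
    congr 1
    ring
  have hs' : ∀ j, 2 * (s * if B g j then 1 else 0) ^ 2 ≤ ρ ^ 2 := by
    intro j
    split_ifs
    · simpa using hs
    · simp; positivity
  rw [e]
  constructor
  · refine Integrable.fintype_prod (𝕜 := ℝ) (μ := fun _ => laplace ρ)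
      (f := fun j z => Real.exp ((s * if B g j then 1 else 0) * z)) fun j => ?_
    have h := abs_lt.1 (abs_lt_of_sq_lt_sq
      (by nlinarith [hs' j, sq_nonneg (s * if B g j then 1 else 0)] :
        (s * if B g j then (1 : ℝ) else 0) ^ 2 < ρ ^ 2) hρ.le)
    exact integrable_exp_laplace h.1 h.2
  · rw [integral_fintype_prod_eq_prod (𝕜 := ℝ)
      (fun j z => Real.exp ((s * if B g j then 1 else 0) * z)),
      show Real.exp (d * (2 * (s ^ 2 / ρ ^ 2))) = ∏ _j : Fin d, Real.exp (2 * (s ^ 2 / ρ ^ 2)) by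
        rw [Finset.prod_const, Finset.card_univ, Fintype.card_fin, ← Real.exp_nat_mul]]
    refine Finset.prod_le_prod (fun j _ => integral_nonneg fun z => (Real.exp_pos _).le)
      fun j _ => (integral_exp_laplace_le hρ (hs' j)).trans (Real.exp_le_exp.2 ?_)
    have h : (s * if B g j then (1 : ℝ) else 0) ^ 2 ≤ s ^ 2 := by
      split_ifs
      · simp
      · simp; positivity
    gcongr
/-- Expected regret of follow the perturbed leader with Laplace noise on the separator. -/
theorem sum_integral_leader_le {ι : Type*} [Fintype ι] [MeasurableSpace ι]
    [MeasurableSingletonClass ι] {d : ℕ} (hd : 0 < d) (hι : 2 ≤ Fintype.card ι)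
    {B : ι → Fin d → Bool} (hB : ∀ g g', g ≠ g' → ∃ j, B g j ≠ B g' j) {ρ : ℝ} (hρ : 0 < ρ)
    {ℓ : ℕ → ι → ℝ} (hℓ : ∀ t g, ℓ t g ∈ Set.Icc (0 : ℝ) 1) {m : ℕ → (Fin d → ℝ) → ι}
    (mm : ∀ t, Measurable (m t))
    (hm : ∀ t η g, ∑ i ∈ Finset.range t, ℓ i (m t η) + perturbation B η (m t η) ≤
      ∑ i ∈ Finset.range t, ℓ i g + perturbation B η g) (T : ℕ) (g : ι) :
    ∑ t ∈ Finset.range T, ∫ η, ℓ t (m t η) ∂(Measure.pi fun _ : Fin d => laplace ρ) ≤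
      ∑ t ∈ Finset.range T, ℓ t g + (T * (d * (ρ / 2)) +
        8 * (√(d : ℝ) * Real.log (Fintype.card ι) / ρ)) := by
  have := isProbabilityMeasure_laplace hρ
  set ν := Measure.pi fun _ : Fin d => laplace ρ
  have hint : ∀ t t', Integrable (fun η => ℓ t (m t' η)) ν := fun t t' =>
    Integrable.of_mem_Icc 0 1 (((measurable_of_countable (ℓ t)).comp (mm t')).aemeasurable)
      (Filter.Eventually.of_forall fun η => hℓ _ _)
  -- one-step stability
  have hstab : ∀ t, ∫ η, ℓ t (m t η) ∂ν ≤ ∫ η, ℓ t (m (t + 1) η) ∂ν + d * (ρ / 2) := by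
    intro t
    have hms : MeasurableSet {η | m t η ≠ m (t + 1) η} :=
      (measurableSet_eq_fun (mm t) (mm (t + 1))).compl
    have hle : ν.real {η | m t η ≠ m (t + 1) η} ≤ d * (ρ / 2) := by
      refine ENNReal.toReal_le_of_le_ofReal (by positivity) ?_
      refine measure_leaders_differ_le (A := fun g => ∑ i ∈ Finset.range t, ℓ i g) hρ (hℓ t) hB
        (mm t) (mm (t + 1)) (hm t) fun η g => ?_
      simpa [Finset.sum_range_succ] using hm (t + 1) η g
    rw [← integral_indicator_one hms] at hle
    refine le_trans ?_ (add_le_add_right hle _)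
    have hi : Integrable ({η | m t η ≠ m (t + 1) η}.indicator (1 : (Fin d → ℝ) → ℝ)) ν :=
      (integrable_const 1).indicator hms
    rw [← integral_add (hint _ _) hi]
    refine integral_mono (hint _ _) ((hint _ _).add hi) fun η => ?_
    by_cases h : m t η = m (t + 1) η
    · simp [h]
    · have h₁ := (hℓ t (m t η)).2
      have h₂ := (hℓ t (m (t + 1) η)).1
      simp [h]
      linarith
  -- the price of the perturbation
  set s : ℝ := ρ / (2 * √(d : ℝ)) with hs
  have hd' : 0 < √(d : ℝ) := Real.sqrt_pos.2 (by exact_mod_cast hd)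
  have hdd : √(d : ℝ) ^ 2 = d := Real.sq_sqrt (by positivity)
  have hd1 : (1 : ℝ) ≤ d := by exact_mod_cast hd
  have hs0 : 0 < s := by positivity
  have hss : s ^ 2 / ρ ^ 2 = 1 / (4 * d) := by
    rw [hs, div_pow, mul_pow, hdd]; field_simp; norm_num
  have hs2 : 2 * s ^ 2 ≤ ρ ^ 2 := by
    have h : s ^ 2 = 1 / (4 * d) * ρ ^ 2 := by rw [← hss]; field_simp
    have : 1 / (4 * (d : ℝ)) ≤ 1 / 4 := by gcongr; linarith
    nlinarith [sq_nonneg ρ]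
  have hexp : (d : ℝ) * (2 * (s ^ 2 / ρ ^ 2)) = 1 / 2 := by rw [hss]; field_simp; norm_num
  set N : ℝ := (Fintype.card ι : ℝ) with hN
  have hN2 : (2 : ℝ) ≤ N := by rw [hN]; exact_mod_cast hι
  have hlog : 1 / 2 ≤ Real.log N := by
    have := Real.log_two_gt_d9
    have := Real.log_le_log (by norm_num) hN2
    linarith
  -- Chosen so that e^{-c} cancels the sum of N moments, each at most e^{1/2}.
  set c : ℝ := Real.log N + 1 / 2 with hc
  have hpt : ∀ η g', s * (perturbation B η g - perturbation B η g') ≤ 2 * (c - 1) +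
      Real.exp (-c) * ∑ k, (Real.exp (s * perturbation B η k) +
        Real.exp (-s * perturbation B η k)) := by
    intro η g'
    -- The tangent line of exp at c bounds the perturbations pointwise, replacing Jensen's
    -- inequality for the logarithm of a sum of exponentials.
    have hb : ∀ x : ℝ, x ≤ c - 1 + Real.exp (-c) * Real.exp x := by
      intro x
      rw [← Real.exp_add]
      have := Real.add_one_le_exp (-c + x)
      linarith
    have h₁ := hb (s * perturbation B η g)
    have h₂ := hb (-s * perturbation B η g')
    have h₃ : Real.exp (s * perturbation B η g) + Real.exp (-s * perturbation B η g') ≤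
        ∑ k, (Real.exp (s * perturbation B η k) + Real.exp (-s * perturbation B η k)) := by
      rw [Finset.sum_add_distrib]
      exact add_le_add
        (Finset.single_le_sum (f := fun k => Real.exp (s * perturbation B η k))
          (fun k _ => (Real.exp_pos _).le) (Finset.mem_univ g))
        (Finset.single_le_sum (f := fun k => Real.exp (-s * perturbation B η k))
          (fun k _ => (Real.exp_pos _).le) (Finset.mem_univ g'))
    have h₄ := mul_le_mul_of_nonneg_left h₃ (Real.exp_pos (-c)).le
    linarith
  have I₁ := fun k => integrable_exp_perturbation B hρ hs2 k
  have I₂ := fun k => integrable_exp_perturbation B (s := -s) hρ (by simpa using hs2) k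
  rw [neg_sq, hexp] at I₂
  rw [hexp] at I₁
  have hsumint : Integrable (fun η => ∑ k, (Real.exp (s * perturbation B η k) +
      Real.exp (-s * perturbation B η k))) ν :=
    integrable_finsetSum _ fun k _ => (I₁ k).1.add (I₂ k).1
  have hsum : ∫ η, ∑ k, (Real.exp (s * perturbation B η k) +
      Real.exp (-s * perturbation B η k)) ∂ν ≤ 2 * Real.exp c := by
    have hadd : ∀ k, Integrable (fun η => Real.exp (s * perturbation B η k) +
        Real.exp (-s * perturbation B η k)) ν := fun k => (I₁ k).1.add (I₂ k).1
    rw [integral_finsetSum _ fun k _ => hadd k]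
    calc _ ≤ ∑ _k : ι, 2 * Real.exp (1 / 2) := by
          refine Finset.sum_le_sum fun k _ => ?_
          rw [integral_add (I₁ k).1 (I₂ k).1]
          linarith [(I₁ k).2, (I₂ k).2]
      _ = 2 * Real.exp c := by
          rw [Finset.sum_const, Finset.card_univ, nsmul_eq_mul, hc, Real.exp_add,
            Real.exp_log (by linarith)]
          ring
  have hpath : ∀ η, s * ∑ t ∈ Finset.range T, ℓ t (m (t + 1) η) ≤
      s * ∑ t ∈ Finset.range T, ℓ t g + (2 * (c - 1) + Real.exp (-c) *
        ∑ k, (Real.exp (s * perturbation B η k) + Real.exp (-s * perturbation B η k))) := by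
    intro η
    have h₁ := be_the_leader (m := fun t => m t η) (fun t => hm t η) T g
    -- The leader before any loss depends on η; the bound is uniform in the second group, so it
    -- applies.
    have h₂ := hpt η (m 0 η)
    nlinarith
  have hmain : s * ∑ t ∈ Finset.range T, ∫ η, ℓ t (m (t + 1) η) ∂ν ≤
      s * ∑ t ∈ Finset.range T, ℓ t g + 2 * c := by
    have hk := hsumint.const_mul (Real.exp (-c))
    have hk' : Integrable (fun η => 2 * (c - 1) + Real.exp (-c) *
        ∑ k, (Real.exp (s * perturbation B η k) + Real.exp (-s * perturbation B η k))) ν :=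
      (integrable_const _).add hk
    have h := integral_mono (μ := ν)
      ((integrable_finsetSum (Finset.range T) fun t _ => hint t (t + 1)).const_mul s)
      ((integrable_const (s * ∑ t ∈ Finset.range T, ℓ t g)).add hk') hpath
    simp only [Pi.add_apply] at h
    rw [integral_const_mul, integral_finsetSum _ fun t _ => hint t (t + 1),
      integral_add (integrable_const _) hk', integral_add (integrable_const _) hk,
      integral_const_mul (Real.exp (-c)), integral_const, integral_const] at h
    simp only [probReal_univ, one_smul] at h
    have h₂ := mul_le_mul_of_nonneg_left hsum (Real.exp_pos (-c)).le
    have h₃ : Real.exp (-c) * (2 * Real.exp c) = 2 := by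
      rw [mul_left_comm, ← Real.exp_add]; simp
    linarith
  have hfin : ∑ t ∈ Finset.range T, ∫ η, ℓ t (m (t + 1) η) ∂ν ≤
      ∑ t ∈ Finset.range T, ℓ t g + 8 * (√(d : ℝ) * Real.log N / ρ) := by
    have h₁ : s * (8 * (√(d : ℝ) * Real.log N / ρ)) = 4 * Real.log N := by
      rw [hs]; field_simp; norm_num
    -- It remains that 2c = 2 log N + 1 ≤ 4 log N, which is where log N ≥ 1/2 enters.
    refine le_of_mul_le_mul_left ?_ hs0
    rw [mul_add, h₁]
    linarith
  calc ∑ t ∈ Finset.range T, ∫ η, ℓ t (m t η) ∂ν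
      ≤ ∑ t ∈ Finset.range T, (∫ η, ℓ t (m (t + 1) η) ∂ν + d * (ρ / 2)) :=
        Finset.sum_le_sum fun t _ => hstab t
    _ = ∑ t ∈ Finset.range T, ∫ η, ℓ t (m (t + 1) η) ∂ν + T * (d * (ρ / 2)) := by
        rw [Finset.sum_add_distrib, Finset.sum_const, Finset.card_range, nsmul_eq_mul]
    _ ≤ _ := by linarith

lemma member_mem_Icc {S : Type u} {X : Type x} (feat : S → X) (g : X → Bool) (s : S) :
    member feat g s ∈ Set.Icc (0 : ℝ) 1 := by
  unfold member
  split_ifs <;> simp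

section Lagrangian

variable {S : Type u} {A : Type v} {Q : Type w} {X : Type x}
variable [MeasurableSpace S] [MeasurableSpace A] [MeasurableSpace Q]

/-! ### The Lagrangian in terms of the average group rewards -/

lemma isMarkovKernel_stateLaw (M : MDP S A) (Pol : PolicyClass S A Q) (h : ℕ) :
    IsMarkovKernel (stateLaw M Pol h) := by
  have := M.init_prob
  have := M.P_markov
  have := Pol.act_markov
  induction h with
  | zero => rw [stateLaw]; infer_instance
  | succ h ih => rw [stateLaw]; infer_instance

lemma isMarkovKernel_stepLaw (M : MDP S A) (Pol : PolicyClass S A Q) (h : ℕ) :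
    IsMarkovKernel (stepLaw M Pol h) := by
  have := isMarkovKernel_stateLaw M Pol h
  have := Pol.act_markov
  rw [stepLaw]
  infer_instance

lemma sampleLaw_apply (M : MDP S A) (Pol : PolicyClass S A Q) (q : Q) :
    sampleLaw M Pol q = (M.H : ℝ≥0∞)⁻¹ • ∑ h ∈ Finset.range M.H, stepLaw M Pol h q := rfl

lemma isMarkovKernel_sampleLaw (M : MDP S A) (Pol : PolicyClass S A Q) :
    IsMarkovKernel (sampleLaw M Pol) := by
  refine ⟨fun q => ⟨?_⟩⟩
  have := isMarkovKernel_stepLaw M Pol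
  have hH : (M.H : ℝ≥0∞) ≠ 0 := by exact_mod_cast M.H_pos.ne'
  rw [sampleLaw_apply, Measure.smul_apply, Measure.finsetSum_apply]
  simp [ENNReal.inv_mul_cancel hH]

lemma integral_sampleLaw (M : MDP S A) (Pol : PolicyClass S A Q) (q : Q) {f : S × A → ℝ}
    (hf : ∀ h, Integrable f (stepLaw M Pol h q)) :
    ∫ z, f z ∂sampleLaw M Pol q =
      (M.H : ℝ)⁻¹ * ∑ h ∈ Finset.range M.H, ∫ z, f z ∂stepLaw M Pol h q := by
  rw [sampleLaw_apply, integral_smul_measure, integral_finsetSum_measure fun h _ => hf h]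
  simp

lemma reward_mul_member_mem_Icc (M : MDP S A) (feat : S → X) (g : X → Bool) (z : S × A) (s : S) :
    M.r z * member feat g s ∈ Set.Icc (0 : ℝ) 1 :=
  unitInterval.mul_mem (M.r_mem z) (member_mem_Icc feat g s)

lemma measurable_member {feat : S → X} {g : X → Bool} (hg : Measurable fun s => g (feat s)) :
    Measurable (member feat g) :=
  Measurable.ite (hg (measurableSet_singleton true)) measurable_const measurable_const

lemma measurable_reward_mul_member (M : MDP S A) {feat : S → X} {g : X → Bool}
    (hg : Measurable fun s => g (feat s)) :
    Measurable fun z : S × A => M.r z * member feat g z.1 :=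
  M.r_measurable.mul ((measurable_member hg).comp measurable_fst)

lemma integrable_reward_mul_member (M : MDP S A) {feat : S → X} {g : X → Bool}
    (hg : Measurable fun s => g (feat s)) (μ : Measure (S × A)) [IsFiniteMeasure μ] :
    Integrable (fun z : S × A => M.r z * member feat g z.1) μ :=
  Integrable.of_mem_Icc 0 1 (measurable_reward_mul_member M hg).aemeasurable
    (Filter.Eventually.of_forall fun _ => reward_mul_member_mem_Icc M feat g _ _)

/-- The expected reward `E[r(s_h, a_h) g(s_h)]` at a uniform time `h`. -/
def groupCost (M : MDP S A) (Pol : PolicyClass S A Q) (feat : S → X) (g : X → Bool)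
    (D : Measure Q) : ℝ :=
  ∫ z, M.r z * member feat g z.1 ∂(D.bind (sampleLaw M Pol))

variable (M : MDP S A) (Pol : PolicyClass S A Q) {feat : S → X} {G : Finset (X → Bool)}

lemma isProbabilityMeasure_bind_sampleLaw (D : Measure Q) [IsProbabilityMeasure D] :
    IsProbabilityMeasure (D.bind (sampleLaw M Pol)) := by
  have := isMarkovKernel_sampleLaw M Pol
  infer_instance

/-- The sum over the horizon is H times the average over a uniform time, so V^g(D) < α is the sign
condition c_g(D) - α/H < 0. -/
lemma groupValue_eq {g : X → Bool} (hg : Measurable fun s => g (feat s)) (D : Measure Q)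
    [IsProbabilityMeasure D] :
    groupValue M Pol feat g D = M.H * groupCost M Pol feat g D := by
  have := isMarkovKernel_sampleLaw M Pol
  have := isMarkovKernel_stepLaw M Pol
  have hH : (M.H : ℝ) ≠ 0 := by exact_mod_cast M.H_pos.ne'
  have := isProbabilityMeasure_bind_sampleLaw M Pol D
  have hbind : ∫ z, M.r z * member feat g z.1 ∂(D.bind (sampleLaw M Pol)) =
      ∫ q, ∫ z, M.r z * member feat g z.1 ∂(sampleLaw M Pol q) ∂D :=
    Kernel.integral_comp (κ := Kernel.const Unit D) (η := sampleLaw M Pol) (a := ())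
      (integrable_reward_mul_member M hg _)
  rw [groupCost, hbind, groupValue, ← integral_const_mul]
  refine integral_congr_ae (Filter.Eventually.of_forall fun q => ?_)
  simp only
  rw [integral_sampleLaw M Pol q fun h => integrable_reward_mul_member M hg _,
    mul_inv_cancel_left₀ hH]

lemma lagrangian_eq (hG : ∀ g ∈ G, Measurable fun s => g (feat s)) (α : ℝ) (D : Measure Q)
    [IsProbabilityMeasure D] (lam : G → ℝ) :
    lagrangian M Pol feat G α D lam = ∫ z, M.r z ∂(D.bind (sampleLaw M Pol)) +
      ∑ g : G, lam g * (groupCost M Pol feat g.1 D - α / M.H) := by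
  have := isProbabilityMeasure_bind_sampleLaw M Pol D
  have hi : ∀ g : G, Integrable (fun z : S × A => lam g * (M.r z * member feat g.1 z.1 - α / M.H))
      (D.bind (sampleLaw M Pol)) := fun g =>
    ((integrable_reward_mul_member M (hG g g.2) _).sub (integrable_const _)).const_mul _
  rw [lagrangian, integral_add _ (integrable_finsetSum _ fun g _ => hi g),
    integral_finsetSum _ fun g _ => hi g]
  · congr 1
    refine Finset.sum_congr rfl fun g _ => ?_
    rw [integral_const_mul, integral_sub (integrable_reward_mul_member M (hG g g.2) _)
      (integrable_const _), integral_const, groupCost]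
    simp
  · exact Integrable.of_mem_Icc 0 1 M.r_measurable.aemeasurable
      (Filter.Eventually.of_forall fun z => M.r_mem z)

lemma sum_oneGroup_mul (C : ℝ) (k : G) (f : G → ℝ) :
    ∑ g, oneGroup G C k g * f g = C * f k := by
  classical
  rw [Finset.sum_eq_single k]
  · simp [oneGroup]
  · intro g _ hg
    simp [oneGroup, hg]
  · simp

lemma oneGroup_mem_fullWeights {C : ℝ} (hC : 0 ≤ C) (k : G) :
    oneGroup G C k ∈ fullWeights G C := by
  classical
  have h : ∀ g, 0 ≤ oneGroup G C k g := fun g => by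
    by_cases hg : g = k
    · subst hg; simpa [oneGroup] using hC
    · simp [oneGroup, hg]
  refine ⟨h, ?_⟩
  simp_rw [abs_of_nonneg (h _)]
  simpa using sum_oneGroup_mul C k fun _ => 1

/-- Low regret in terms of the group rewards bounds the regret in terms of the Lagrangian. -/
theorem regret_le_of_groupCost (hG : ∀ g ∈ G, Measurable fun s => g (feat s)) {α C ε : ℝ}
    (hC : 0 < C) (hε : 0 ≤ ε) {T : ℕ} (D : Fin T → Measure Q)
    (hD : ∀ t, IsProbabilityMeasure (D t)) (sel : Fin T → G) [Nonempty G]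
    (hreg : ∀ g : G, C * ∑ t, (groupCost M Pol feat (sel t).1 (D t) -
      groupCost M Pol feat g.1 (D t)) ≤ ε) :
    regret M Pol feat G α D (fun t => violatedGroup M Pol feat G α C (D t) (sel t))
        (weights G C) ≤ ε ∧
      regret M Pol feat G α D (fun t => oneGroup G C (sel t)) (fullWeights G C) ≤ ε ∧
      ((∃ g ∈ G, ∑ t, groupValue M Pol feat g (D t) ≤ T * α) →
        regret M Pol feat G α D (fun t => oneGroup G C (sel t)) (weights G C) ≤ ε) := by
  have hH : (0 : ℝ) < M.H := by exact_mod_cast M.H_pos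
  set R : ℝ := ∑ t, ∫ z, M.r z ∂((D t).bind (sampleLaw M Pol)) with hR
  set f : G → Fin T → ℝ := fun g t => groupCost M Pol feat g.1 (D t) - α / M.H with hf
  have hlag : ∀ lam : G → ℝ, ∑ t, lagrangian M Pol feat G α (D t) lam =
      R + ∑ g, lam g * ∑ t, f g t := by
    intro lam
    simp_rw [lagrangian_eq M Pol hG, Finset.sum_add_distrib, Finset.mul_sum]
    rw [Finset.sum_comm]
  have hone : ∑ t, lagrangian M Pol feat G α (D t) (oneGroup G C (sel t)) =
      R + C * ∑ t, f (sel t) t := by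
    simp_rw [lagrangian_eq M Pol hG, Finset.sum_add_distrib,
      sum_oneGroup_mul C _ fun g : G => groupCost M Pol feat g.1 (D _) - α / M.H, Finset.mul_sum]
    rfl
  -- The null action is taken exactly when the slope of the selected group is nonnegative, so it
  -- truncates that slope at 0.
  have hviol : ∑ t, lagrangian M Pol feat G α (D t)
      (violatedGroup M Pol feat G α C (D t) (sel t)) = R + C * ∑ t, min (f (sel t) t) 0 := by
    simp_rw [lagrangian_eq M Pol hG, Finset.sum_add_distrib, Finset.mul_sum]
    congr 1
    refine Finset.sum_congr rfl fun t _ => ?_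
    have hv : groupValue M Pol feat (sel t).1 (D t) < α ↔ f (sel t) t < 0 := by
      rw [groupValue_eq M Pol (hG _ (sel t).2), hf]
      simp only
      rw [sub_neg, lt_div_iff₀ hH, mul_comm]
    unfold violatedGroup
    split_ifs with h
    · rw [min_eq_left (hv.1 h).le, sum_oneGroup_mul C _ fun g : G => f g t]
    · rw [min_eq_right (not_lt.1 (hv.not.1 h))]
      simp
  have hreg' : ∀ g : G, C * ∑ t, f (sel t) t ≤ C * ∑ t, f g t + ε := by
    intro g
    have h := hreg g
    have e : ∑ t, (groupCost M Pol feat (sel t).1 (D t) - groupCost M Pol feat g.1 (D t)) =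
        ∑ t, f (sel t) t - ∑ t, f g t := by
      rw [← Finset.sum_sub_distrib]
      exact Finset.sum_congr rfl fun t _ => by simp [hf]
    rw [e] at h
    linarith
  -- the best group
  obtain ⟨k, hk⟩ := Finite.exists_min fun g : G => ∑ t, f g t
  -- Linearity in λ: for a given norm, putting all the weight on the best group is optimal.
  have hcomb : ∀ lam : G → ℝ, (∀ g, 0 ≤ lam g) →
      (∑ g, |lam g|) * ∑ t, f k t ≤ ∑ g, lam g * ∑ t, f g t := by
    intro lam h
    rw [Finset.sum_mul]
    refine Finset.sum_le_sum fun g _ => ?_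
    rw [abs_of_nonneg (h g)]
    exact mul_le_mul_of_nonneg_left (hk g) (h g)
  have hsInf : ∀ (B : Set (G → ℝ)) (a : ℝ), B.Nonempty →
      (∀ lam ∈ B, a - ε ≤ ∑ t, lagrangian M Pol feat G α (D t) lam) →
      a - sInf ((fun l => ∑ t, lagrangian M Pol feat G α (D t) l) '' B) ≤ ε := by
    intro B a hB h
    have := le_csInf (hB.image _) (Set.forall_mem_image.2 h)
    linarith
  have hfull := oneGroup_mem_fullWeights hC.le k
  have hw : (weights G C).Nonempty := ⟨_, hfull.1, hfull.2.le⟩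
  refine ⟨?_, ?_, ?_⟩
  · refine hsInf _ _ hw fun lam hlam => ?_
    rw [hviol, hlag]
    have h₁ := hcomb lam hlam.1
    have h₂ : ∑ t, min (f (sel t) t) 0 ≤ ∑ t, f (sel t) t :=
      Finset.sum_le_sum fun t _ => min_le_left _ _
    have h₃ : ∑ t, min (f (sel t) t) 0 ≤ 0 := Finset.sum_nonpos fun t _ => min_le_right _ _
    have h₄ := hreg' k
    have h₅ : 0 ≤ ∑ g, |lam g| := Finset.sum_nonneg fun g _ => abs_nonneg _
    -- If the best total slope is nonnegative, no comparator beats 0, and the truncated sum is at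
    -- most 0. Otherwise the best comparator is C e_k, and truncation only lowers the regulator's
    -- sum.
    rcases le_total 0 (∑ t, f k t) with h | h
    · have := mul_nonneg h₅ h
      nlinarith
    · have := mul_le_mul_of_nonpos_right hlam.2 h
      nlinarith
  · refine hsInf _ _ ⟨_, hfull⟩ fun lam hlam => ?_
    rw [hone, hlag]
    have h₁ := hcomb lam hlam.1
    rw [hlam.2] at h₁
    linarith [hreg' k]
  · rintro ⟨g, hg, hslack⟩
    -- A constraint that is not strictly slack makes the best total slope nonpositive, so using the
    -- full norm C is optimal within Λ.
    have hneg : ∑ t, f k t ≤ 0 := by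
      refine (hk ⟨g, hg⟩).trans ?_
      have e : ∑ t, groupValue M Pol feat g (D t) = M.H * (∑ t, f ⟨g, hg⟩ t) + T * α := by
        have e₁ : ∀ t, groupValue M Pol feat g (D t) = M.H * f ⟨g, hg⟩ t + α := fun t => by
          rw [groupValue_eq M Pol (hG g hg), hf]
          field_simp
          ring
        simp_rw [e₁, Finset.sum_add_distrib, Finset.mul_sum]
        simp
      have : M.H * (∑ t, f ⟨g, hg⟩ t) ≤ 0 := by linarith
      exact nonpos_of_mul_nonpos_right this hH
    refine hsInf _ _ hw fun lam hlam => ?_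
    rw [hone, hlag]
    have h₁ := hcomb lam hlam.1
    have := mul_le_mul_of_nonpos_right hlam.2 hneg
    linarith [hreg' k]

end Lagrangian

lemma sum_increments_snoc {S : Type u} {A : Type v} {W : Type y} {d : ℕ}
    {ζ : ∀ t, History W S A d t → Round S A d → ℝ} {T : ℕ} (h : History W S A d T) (z : Round S A d) :
    ∑ t : Fin (T + 1), ζ t (before ((h.1, Fin.snoc h.2 z) : History W S A d (T + 1)) t)
        ((Fin.snoc h.2 z : Fin (T + 1) → Round S A d) t) =
      ∑ t : Fin T, ζ t (before h t) (h.2 t) + ζ T h z := by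
  have e₁ : ∀ t : Fin T, before ((h.1, Fin.snoc h.2 z) : History W S A d (T + 1)) t.castSucc =
      before h t := fun t => Prod.ext rfl (funext fun i =>
    Fin.snoc_castSucc (α := fun _ => Round S A d) z h.2 ⟨i, i.2.trans t.2⟩)
  have e₂ : before ((h.1, Fin.snoc h.2 z) : History W S A d (T + 1)) (Fin.last T) = h :=
    Prod.ext rfl (funext fun i => Fin.snoc_castSucc (α := fun _ => Round S A d) z h.2 i)
  rw [Fin.sum_univ_castSucc, e₂, Fin.snoc_last]
  simp only [e₁, Fin.snoc_castSucc]
  rfl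

section Concentration

variable {S : Type u} {A : Type v} {Q : Type w} {X : Type x} {W : Type y}
variable [MeasurableSpace S] [MeasurableSpace A] [MeasurableSpace Q] [MeasurableSpace W]
variable {d : ℕ}

/-! ### Azuma's inequality along the history of the game -/

lemma isMarkovKernel_sampleLaw_comp_play (M : MDP S A) (Pol : PolicyClass S A Q)
    (L : Learner W S A Q d) (t : ℕ) : IsMarkovKernel (sampleLaw M Pol ∘ₖ L.play t) := by
  have := isMarkovKernel_sampleLaw M Pol
  have := L.play_markov t
  infer_instance

lemma isMarkovKernel_roundLaw (M : MDP S A) (Pol : PolicyClass S A Q) (L : Learner W S A Q d)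
    {ρ : ℝ} (hρ : 0 < ρ) (t : ℕ) : IsMarkovKernel (roundLaw M Pol L ρ t) := by
  have := isProbabilityMeasure_laplace hρ
  have := isMarkovKernel_sampleLaw_comp_play M Pol L t
  rw [roundLaw]
  infer_instance

lemma roundLaw_apply (M : MDP S A) (Pol : PolicyClass S A Q) (L : Learner W S A Q d)
    {ρ : ℝ} (hρ : 0 < ρ) (t : ℕ) (h : History W S A d t) :
    roundLaw M Pol L ρ t h = (Measure.pi fun _ : Fin d => laplace ρ).prod
      ((L.play t h).bind (sampleLaw M Pol)) := by
  have := isProbabilityMeasure_laplace hρ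
  have := isMarkovKernel_sampleLaw_comp_play M Pol L t
  rw [roundLaw, Kernel.prod_apply, Kernel.const_apply, Kernel.comp_apply]

lemma measurable_snoc (t : ℕ) : Measurable fun p : History W S A d t × Round S A d =>
    ((p.1.1, Fin.snoc p.1.2 p.2) : History W S A d (t + 1)) := by
  refine (measurable_fst.comp measurable_fst).prodMk (measurable_pi_iff.2 fun i => ?_)
  induction i using Fin.lastCases with
  | last => simpa using measurable_snd
  | cast i =>
    simp only [Fin.snoc_castSucc]
    exact (measurable_pi_apply i).comp (measurable_snd.comp measurable_fst)

lemma measurable_before {T : ℕ} (t : Fin T) :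
    Measurable fun ω : History W S A d T => before ω t :=
  measurable_fst.prodMk (measurable_pi_iff.2 fun _ => (measurable_pi_apply _).comp measurable_snd)

lemma isProbabilityMeasure_historyLaw (M : MDP S A) (Pol : PolicyClass S A Q)
    (L : Learner W S A Q d) {ρ : ℝ} (hρ : 0 < ρ) (t : ℕ) :
    IsProbabilityMeasure (historyLaw M Pol L ρ t) := by
  have := L.seed_prob
  have := isMarkovKernel_roundLaw M Pol L hρ
  induction t with
  | zero =>
    rw [historyLaw]
    exact Measure.isProbabilityMeasure_map (by fun_prop)
  | succ t ih =>
    rw [historyLaw]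
    exact Measure.isProbabilityMeasure_map (measurable_snoc t).aemeasurable

variable {ζ : ∀ t, History W S A d t → Round S A d → ℝ}

lemma measurable_sum_increments (hζ : ∀ t, Measurable (Function.uncurry (ζ t))) (T : ℕ) :
    Measurable fun ω : History W S A d T => ∑ t : Fin T, ζ t (before ω t) (ω.2 t) :=
  Finset.measurable_sum _ fun t _ =>
    (hζ t).comp ((measurable_before t).prodMk ((measurable_pi_apply t).comp measurable_snd))

variable (M : MDP S A) (Pol : PolicyClass S A Q) (L : Learner W S A Q d) {ρ : ℝ}

/-- The last increment has conditional mean zero, so Hoeffding's lemma bounds its conditional moment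
by e^{2s²} for every history; induction on T multiplies these factors. -/
lemma lintegral_exp_sum_increments_le (hρ : 0 < ρ)
    (hζ : ∀ t, Measurable (Function.uncurry (ζ t)))
    (hb : ∀ t h z, ζ t h z ∈ Set.Icc (-2 : ℝ) 2)
    (h0 : ∀ t h, ∫ z, ζ t h z ∂roundLaw M Pol L ρ t h = 0) (s : ℝ) (T : ℕ) :
    ∫⁻ ω, ENNReal.ofReal (Real.exp (s * ∑ t : Fin T, ζ t (before ω t) (ω.2 t)))
      ∂historyLaw M Pol L ρ T ≤ ENNReal.ofReal (Real.exp (2 * s ^ 2 * T)) := by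
  have hR := isMarkovKernel_roundLaw M Pol L hρ
  have hP := isProbabilityMeasure_historyLaw M Pol L hρ
  have hm : ∀ T, Measurable fun ω : History W S A d T =>
      ENNReal.ofReal (Real.exp (s * ∑ t : Fin T, ζ t (before ω t) (ω.2 t))) := fun T =>
    (Real.measurable_exp.comp ((measurable_sum_increments hζ T).const_mul s)).ennreal_ofReal
  induction T with
  | zero => simp
  | succ T ih =>
    rw [historyLaw, lintegral_map (hm _) (measurable_snoc T)]
    refine (Measure.lintegral_compProd ((hm _).comp (measurable_snoc T))).trans_le ?_
    simp only [Function.comp_apply]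
    have hstep : ∀ h : History W S A d T,
        ∫⁻ z, ENNReal.ofReal (Real.exp (s * ζ T h z)) ∂roundLaw M Pol L ρ T h ≤
          ENNReal.ofReal (Real.exp (2 * s ^ 2)) := by
      intro h
      have hmz : Measurable (ζ T h) := (hζ T).of_uncurry_left
      have hsub := hasSubgaussianMGF_of_mem_Icc_of_integral_eq_zero hmz.aemeasurable
        (Filter.Eventually.of_forall (hb T h)) (h0 T h)
      rw [← ofReal_integral_eq_lintegral_ofReal (hsub.integrable_exp_mul s)
        (Filter.Eventually.of_forall fun z => (Real.exp_pos _).le)]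
      refine ENNReal.ofReal_le_ofReal ((hsub.mgf_le s).trans (Real.exp_le_exp.2 (le_of_eq ?_)))
      -- An interval of length 4 gives variance proxy (4/2)² = 4, hence exponent 4s²/2.
      have : ‖(2 : ℝ) - -2‖ = 4 := by norm_num
      push_cast
      rw [this]
      ring
    calc _ = ∫⁻ h, ENNReal.ofReal (Real.exp (s * ∑ t : Fin T, ζ t (before h t) (h.2 t))) *
          ∫⁻ z, ENNReal.ofReal (Real.exp (s * ζ T h z)) ∂roundLaw M Pol L ρ T h
            ∂historyLaw M Pol L ρ T := by
          refine lintegral_congr fun h => ?_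
          rw [← lintegral_const_mul]
          · refine lintegral_congr fun z => ?_
            rw [← ENNReal.ofReal_mul (Real.exp_pos _).le, ← Real.exp_add, ← mul_add,
              sum_increments_snoc]
          · exact (Real.measurable_exp.comp
              ((hζ T).of_uncurry_left.const_mul s)).ennreal_ofReal
      _ ≤ ∫⁻ h, ENNReal.ofReal (Real.exp (s * ∑ t : Fin T, ζ t (before h t) (h.2 t))) *
          ENNReal.ofReal (Real.exp (2 * s ^ 2)) ∂historyLaw M Pol L ρ T :=
          lintegral_mono fun h => mul_le_mul_right (hstep h) _
      _ ≤ ENNReal.ofReal (Real.exp (2 * s ^ 2 * T)) * ENNReal.ofReal (Real.exp (2 * s ^ 2)) := by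
          rw [lintegral_mul_const _ (hm T)]
          exact mul_le_mul_left ih _
      _ = _ := by
          rw [← ENNReal.ofReal_mul (Real.exp_pos _).le, ← Real.exp_add]
          congr 2
          push_cast
          ring

theorem historyLaw_sum_increments_ge_le (hρ : 0 < ρ)
    (hζ : ∀ t, Measurable (Function.uncurry (ζ t)))
    (hb : ∀ t h z, ζ t h z ∈ Set.Icc (-2 : ℝ) 2)
    (h0 : ∀ t h, ∫ z, ζ t h z ∂roundLaw M Pol L ρ t h = 0) {T : ℕ} (hT : 0 < T) {ε : ℝ}
    (hε : 0 ≤ ε) :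
    historyLaw M Pol L ρ T {ω | ε ≤ ∑ t : Fin T, ζ t (before ω t) (ω.2 t)} ≤
      ENNReal.ofReal (Real.exp (-(ε ^ 2 / (8 * T)))) := by
  have hT' : (0 : ℝ) < T := by exact_mod_cast hT
  -- The minimizer of the Chernoff exponent 2s²T - sε.
  set s : ℝ := ε / (4 * T) with hs
  have hs0 : 0 ≤ s := by positivity
  have hE : ENNReal.ofReal (Real.exp (s * ε)) ≠ 0 := by simp [Real.exp_pos]
  have hsub : {ω : History W S A d T | ε ≤ ∑ t : Fin T, ζ t (before ω t) (ω.2 t)} ⊆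
      {ω | ENNReal.ofReal (Real.exp (s * ε)) ≤
        ENNReal.ofReal (Real.exp (s * ∑ t : Fin T, ζ t (before ω t) (ω.2 t)))} := fun ω hω =>
    ENNReal.ofReal_le_ofReal (Real.exp_le_exp.2 (mul_le_mul_of_nonneg_left hω hs0))
  have hm : Measurable fun ω : History W S A d T =>
      ENNReal.ofReal (Real.exp (s * ∑ t : Fin T, ζ t (before ω t) (ω.2 t))) :=
    (Real.measurable_exp.comp ((measurable_sum_increments hζ T).const_mul s)).ennreal_ofReal
  have h := (mul_meas_ge_le_lintegral hm (ENNReal.ofReal (Real.exp (s * ε)))).trans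
    (lintegral_exp_sum_increments_le M Pol L hρ hζ hb h0 s T)
  refine (measure_mono hsub).trans ?_
  have e : ENNReal.ofReal (Real.exp (2 * s ^ 2 * T)) = ENNReal.ofReal (Real.exp (s * ε)) *
      ENNReal.ofReal (Real.exp (-(ε ^ 2 / (8 * T)))) := by
    rw [← ENNReal.ofReal_mul (Real.exp_pos _).le, ← Real.exp_add, hs]
    congr 2
    field_simp
    ring
  rw [e] at h
  exact (ENNReal.mul_le_mul_iff_right hE ENNReal.ofReal_ne_top).1 h

end Concentration

/-- The index type needs no σ-algebra: measurable fibres suffice, as the oracle's tie-breaking rule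
provides for groups. -/
lemma measurable_of_finite_index {Ω ι : Type*} [MeasurableSpace Ω] [Finite ι] {m : Ω → ι}
    (hm : ∀ k, MeasurableSet {ω | m ω = k}) {f : ι → Ω → ℝ} (hf : ∀ k, Measurable (f k)) :
    Measurable fun ω => f (m ω) ω := by
  classical
  have := Fintype.ofFinite ι
  have e : (fun ω => f (m ω) ω) = fun ω => ∑ k, if m ω = k then f k ω else 0 := by
    funext ω
    simp
  rw [e]
  exact Finset.measurable_sum _ fun k _ => Measurable.ite (hm k) (hf k) measurable_const

section Game

variable {S : Type u} {A : Type v} {Q : Type w} {X : Type x} {W : Type y}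
variable [MeasurableSpace S] [MeasurableSpace A] [MeasurableSpace Q] [MeasurableSpace W]
variable {d : ℕ} {feat : S → X} {G : Finset (X → Bool)}

/-! ### Martingale differences of the regulator -/

/-- The group selected after `t` rounds with data `z` when the noise is `η`. -/
def leader (M : MDP S A) (O : OptOracle feat G) (sep : Fin d → S) {t : ℕ} (z : Fin t → S × A)
    (η : Fin d → ℝ) : G :=
  O.opt (t + d) (Fin.append (fun i => (z i).1) sep, Fin.append (fun i => M.r (z i)) η)

variable (M : MDP S A) (Pol : PolicyClass S A Q) (O : OptOracle feat G) (sep : Fin d → S)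
  (L : Learner W S A Q d) (ρ : ℝ)

lemma measurableSet_leader_eq {t : ℕ} (k : G) :
    MeasurableSet {p : (Fin t → S × A) × (Fin d → ℝ) | leader M O sep p.1 p.2 = k} := by
  have h : Measurable fun p : (Fin t → S × A) × (Fin d → ℝ) =>
      ((Fin.append (fun i => (p.1 i).1) sep, Fin.append (fun i => M.r (p.1 i)) p.2) :
        (Fin (t + d) → S) × (Fin (t + d) → ℝ)) := by
    have hp : ∀ i : Fin t, Measurable fun p : (Fin t → S × A) × (Fin d → ℝ) => p.1 i := fun i =>
      (measurable_pi_apply i).comp measurable_fst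
    refine Measurable.prodMk (measurable_pi_iff.2 fun i => ?_) (measurable_pi_iff.2 fun i => ?_)
    · induction i using Fin.addCases with
      | left i => simp only [Fin.append_left]; exact measurable_fst.comp (hp i)
      | right i => simp only [Fin.append_right, measurable_const]
    · induction i using Fin.addCases with
      | left i => simp only [Fin.append_left]; exact M.r_measurable.comp (hp i)
      | right i =>
        simp only [Fin.append_right]; exact (measurable_pi_apply i).comp measurable_snd
  exact h (O.opt_measurable (t + d) k)

/-- The oracle's objective splits into past losses and separator points weighted by noise; the
latter part is the perturbation. -/
lemma leader_le {t : ℕ} (z : Fin t → S × A) (η : Fin d → ℝ) (g : G) :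
    ∑ i, M.r (z i) * member feat (leader M O sep z η).1 (z i).1 +
        perturbation (fun (g : G) j => g.1 (feat (sep j))) η (leader M O sep z η) ≤
      ∑ i, M.r (z i) * member feat g.1 (z i).1 +
        perturbation (fun (g : G) j => g.1 (feat (sep j))) η g := by
  have h := O.opt_le (t + d) (Fin.append (fun i => (z i).1) sep)
    (Fin.append (fun i => M.r (z i)) η) g.1 g.2
  simp only [Fin.sum_univ_add, Fin.append_left, Fin.append_right] at h
  exact h

/-- The states and actions observed in the first `t` rounds. -/
def observed {t : ℕ} (h : History W S A d t) : Fin t → S × A := fun i => (h.2 i).2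

/-- The probability, over the noise, that the selected group contains the state `s`. -/
def coverProb {t : ℕ} (z : Fin t → S × A) (s : S) : ℝ :=
  ∫ η, member feat (leader M O sep z η).1 s ∂(Measure.pi fun _ : Fin d => laplace ρ)

/-- The deviation of round `t` from its conditional mean, in the comparison with the group `g`. -/
def increment (g : G) (t : ℕ) (h : History W S A d t) (z : Round S A d) : ℝ :=
  (groupCost M Pol feat (leader M O sep (observed h) z.1).1 (L.play t h) -
      M.r z.2 * coverProb M O sep ρ (observed h) z.2.1) +
    (M.r z.2 * member feat g.1 z.2.1 - groupCost M Pol feat g.1 (L.play t h))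

lemma measurable_observed {t : ℕ} :
    Measurable (observed : History W S A d t → Fin t → S × A) :=
  measurable_pi_iff.2 fun i =>
    measurable_snd.comp ((measurable_pi_apply i).comp measurable_snd)

lemma groupCost_mem_Icc {g : X → Bool} (hg : Measurable fun s => g (feat s)) (D : Measure Q)
    [IsProbabilityMeasure D] : groupCost M Pol feat g D ∈ Set.Icc (0 : ℝ) 1 := by
  have := isProbabilityMeasure_bind_sampleLaw M Pol D
  refine ⟨integral_nonneg fun z => (reward_mul_member_mem_Icc M feat g z z.1).1, ?_⟩
  refine (integral_mono (integrable_reward_mul_member M hg _) (integrable_const 1)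
    fun z => (reward_mul_member_mem_Icc M feat g z z.1).2).trans ?_
  simp

lemma measurable_groupCost_play {g : X → Bool} (hg : Measurable fun s => g (feat s)) (t : ℕ) :
    Measurable fun h => groupCost M Pol feat g (L.play t h) := by
  have h := (measurable_reward_mul_member M hg).stronglyMeasurable.integral_kernel
    (κ := sampleLaw M Pol ∘ₖ L.play t)
  simp only [Kernel.comp_apply] at h
  exact h.measurable

lemma measurable_member_leader (hG : ∀ g ∈ G, Measurable fun s => g (feat s))
    {t : ℕ} :
    Measurable fun p : ((Fin t → S × A) × S) × (Fin d → ℝ) =>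
      member feat (leader M O sep p.1.1 p.2).1 p.1.2 :=
  measurable_of_finite_index (m := fun p : ((Fin t → S × A) × S) × (Fin d → ℝ) =>
      leader M O sep p.1.1 p.2) (f := fun k p => member feat k.1 p.1.2)
    (fun k => ((measurable_fst.comp measurable_fst).prodMk measurable_snd)
      (measurableSet_leader_eq M O sep k))
    fun k => (measurable_member (hG k k.2)).comp (measurable_snd.comp measurable_fst)

lemma measurable_coverProb (hG : ∀ g ∈ G, Measurable fun s => g (feat s))
    (hρ : 0 < ρ) {t : ℕ} :
    Measurable fun p : (Fin t → S × A) × S => coverProb M O sep ρ p.1 p.2 := by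
  have := isProbabilityMeasure_laplace hρ
  exact (measurable_member_leader M O sep hG).stronglyMeasurable.integral_prod_right'.measurable

lemma coverProb_mem_Icc (hG : ∀ g ∈ G, Measurable fun s => g (feat s))
    (hρ : 0 < ρ) {t : ℕ} (z : Fin t → S × A) (s : S) :
    coverProb M O sep ρ z s ∈ Set.Icc (0 : ℝ) 1 := by
  have := isProbabilityMeasure_laplace hρ
  refine ⟨integral_nonneg fun η => (member_mem_Icc feat _ s).1, ?_⟩
  refine (integral_mono (g := fun _ => 1) ?_ (integrable_const 1)
    fun η => (member_mem_Icc feat _ s).2).trans (by simp)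
  exact Integrable.of_mem_Icc 0 1
    ((measurable_member_leader M O sep hG).comp (measurable_prodMk_left (x := (z, s)))).aemeasurable
    (Filter.Eventually.of_forall fun η => member_mem_Icc feat _ s)

lemma measurable_groupCost_leader (hG : ∀ g ∈ G, Measurable fun s => g (feat s))
    (t : ℕ) :
    Measurable fun p : History W S A d t × (Fin d → ℝ) =>
      groupCost M Pol feat (leader M O sep (observed p.1) p.2).1 (L.play t p.1) :=
  measurable_of_finite_index (m := fun p : History W S A d t × (Fin d → ℝ) =>
      leader M O sep (observed p.1) p.2)
    (f := fun k p => groupCost M Pol feat k.1 (L.play t p.1))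
    (fun k => ((measurable_observed.comp measurable_fst).prodMk measurable_snd)
      (measurableSet_leader_eq M O sep k))
    fun k => (measurable_groupCost_play M Pol L (hG k k.2) t).comp measurable_fst

lemma measurable_increment (hG : ∀ g ∈ G, Measurable fun s => g (feat s))
    (hρ : 0 < ρ) (g : G) (t : ℕ) :
    Measurable (Function.uncurry (increment M Pol O sep L ρ g t)) := by
  have hz : Measurable fun p : History W S A d t × Round S A d => p.2.2 :=
    measurable_snd.comp measurable_snd
  have hφ : Measurable fun p : History W S A d t × Round S A d => (p.1, p.2.1) :=
    measurable_fst.prodMk (measurable_fst.comp measurable_snd)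
  have h₁ : Measurable fun p : History W S A d t × Round S A d =>
      groupCost M Pol feat (leader M O sep (observed p.1) p.2.1).1 (L.play t p.1) := by
    simpa only [Function.comp_def] using (measurable_groupCost_leader M Pol O sep L hG t).comp hφ
  have h₂ : Measurable fun p : History W S A d t × Round S A d =>
      coverProb M O sep ρ (observed p.1) p.2.2.1 :=
    (measurable_coverProb M O sep ρ hG hρ).comp
      ((measurable_observed.comp measurable_fst).prodMk (measurable_fst.comp hz))
  have h₃ : Measurable fun p : History W S A d t × Round S A d => M.r p.2.2 :=
    M.r_measurable.comp hz
  have h₄ : Measurable fun p : History W S A d t × Round S A d =>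
      M.r p.2.2 * member feat g.1 p.2.2.1 := (measurable_reward_mul_member M (hG g g.2)).comp hz
  have h₅ : Measurable fun p : History W S A d t × Round S A d =>
      groupCost M Pol feat g.1 (L.play t p.1) :=
    (measurable_groupCost_play M Pol L (hG g g.2) t).comp measurable_fst
  exact (h₁.sub (h₃.mul h₂)).add (h₄.sub h₅)

lemma increment_mem_Icc (hG : ∀ g ∈ G, Measurable fun s => g (feat s))
    (hρ : 0 < ρ) (g : G) (t : ℕ) (h : History W S A d t)
    (z : Round S A d) : increment M Pol O sep L ρ g t h z ∈ Set.Icc (-2 : ℝ) 2 := by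
  have := L.play_markov t
  have h₁ := groupCost_mem_Icc M Pol
    (hG _ (leader M O sep (observed h) z.1).2) (L.play t h)
  have h₂ := groupCost_mem_Icc M Pol (hG g g.2) (L.play t h)
  have h₃ := reward_mul_member_mem_Icc M feat g.1 z.2 z.2.1
  have h₄ := unitInterval.mul_mem (M.r_mem z.2)
    (coverProb_mem_Icc M O sep ρ hG hρ (observed h) z.2.1)
  unfold increment
  constructor <;> linarith [h₁.1, h₁.2, h₂.1, h₂.2, h₃.1, h₃.2, h₄.1, h₄.2]

lemma integral_increment (hG : ∀ g ∈ G, Measurable fun s => g (feat s))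
    (hρ : 0 < ρ) (g : G) (t : ℕ) (h : History W S A d t) :
    ∫ z, increment M Pol O sep L ρ g t h z ∂roundLaw M Pol L ρ t h = 0 := by
  have := isProbabilityMeasure_laplace hρ
  have := L.play_markov t
  have := isProbabilityMeasure_bind_sampleLaw M Pol (L.play t h)
  rw [roundLaw_apply M Pol L hρ]
  set ν := Measure.pi fun _ : Fin d => laplace ρ with hν
  set μ := (L.play t h).bind (sampleLaw M Pol) with hμ
  have hc : Integrable (fun η => groupCost M Pol feat (leader M O sep (observed h) η).1
      (L.play t h)) ν :=
    Integrable.of_mem_Icc 0 1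
      ((measurable_groupCost_leader M Pol O sep L hG t).comp (measurable_prodMk_left (x := h))).aemeasurable
      (Filter.Eventually.of_forall fun η => groupCost_mem_Icc M Pol (hG _ (Subtype.prop _)) _)
  have hp : Integrable (fun z : S × A => M.r z * coverProb M O sep ρ (observed h) z.1) μ := by
    refine Integrable.of_mem_Icc 0 1 (M.r_measurable.mul
      ((measurable_coverProb M O sep ρ hG hρ).comp
        (measurable_const.prodMk measurable_fst))).aemeasurable
      (Filter.Eventually.of_forall fun z => unitInterval.mul_mem (M.r_mem z)
        (coverProb_mem_Icc M O sep ρ hG hρ _ _))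
  have hg := integrable_reward_mul_member M (hG g g.2) μ
  -- The noise and the sampled pair are independent given the history, so Fubini exchanges their
  -- averages.
  have hmean : ∫ z, M.r z * coverProb M O sep ρ (observed h) z.1 ∂μ =
      ∫ η, groupCost M Pol feat (leader M O sep (observed h) η).1 (L.play t h) ∂ν := by
    simp only [coverProb, groupCost, ← integral_const_mul]
    refine integral_integral_swap (Integrable.of_mem_Icc 0 1 (Measurable.aemeasurable ?_)
      (Filter.Eventually.of_forall fun p => reward_mul_member_mem_Icc M feat _ _ _))
    exact (M.r_measurable.comp measurable_fst).mul ((measurable_member_leader M O sep hG).comp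
      ((measurable_const.prodMk (measurable_fst.comp measurable_fst)).prodMk measurable_snd))
  have i₁ := hc.comp_fst μ
  have i₂ := hp.comp_snd ν
  have i₃ := hg.comp_snd ν
  have hs₁ : Integrable (fun z : (Fin d → ℝ) × S × A =>
      groupCost M Pol feat (leader M O sep (observed h) z.1).1 (L.play t h) -
        M.r z.2 * coverProb M O sep ρ (observed h) z.2.1) (ν.prod μ) := i₁.sub i₂
  have hs₂ : Integrable (fun z : (Fin d → ℝ) × S × A =>
      M.r z.2 * member feat g.1 z.2.1 - groupCost M Pol feat g.1 (L.play t h)) (ν.prod μ) :=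
    i₃.sub (integrable_const _)
  simp only [increment]
  rw [integral_add hs₁ hs₂, integral_sub i₁ i₂,
    integral_sub i₃ (integrable_const _),
    integral_fun_fst (fun η => groupCost M Pol feat (leader M O sep (observed h) η).1 (L.play t h)),
    integral_fun_snd (fun z : S × A => M.r z * coverProb M O sep ρ (observed h) z.1),
    integral_fun_snd (fun z : S × A => M.r z * member feat g.1 z.1), hmean]
  simp [groupCost, hμ]

end Game

/-- The regret of the observed losses against a fresh copy of the noise. -/
theorem sum_reward_mul_coverProb_le {S : Type u} {A : Type v} {X : Type x} {W : Type y}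
    [MeasurableSpace S] [MeasurableSpace A] {d : ℕ} {feat : S → X} {G : Finset (X → Bool)}
    (M : MDP S A) (O : OptOracle feat G) (sep : Fin d → S) {ρ : ℝ} (hcard : 2 ≤ G.card)
    (hsep : IsSeparator feat G (Set.range sep)) (hρ : 0 < ρ) (hd : 0 < d) {T : ℕ} (hT : 0 < T)
    (ω : History W S A d T) (g : G) :
    ∑ t, M.r (ω.2 t).2 * coverProb M O sep ρ (observed (before ω t)) (ω.2 t).2.1 ≤
      ∑ t, M.r (ω.2 t).2 * member feat g.1 (ω.2 t).2.1 +
        (T * (d * (ρ / 2)) + 8 * (√(d : ℝ) * Real.log G.card / ρ)) := by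
  let _ : MeasurableSpace G := ⊤
  -- The path is extended to all of ℕ; the values from T on are irrelevant and repeat round 0.
  set σ : ℕ → S × A := fun i => if h : i < T then (ω.2 ⟨i, h⟩).2 else (ω.2 ⟨0, hT⟩).2 with hσ
  have hσ' : ∀ t : Fin T, σ t = (ω.2 t).2 := fun t => by simp [hσ]
  have hB : ∀ k k' : G, k ≠ k' → ∃ j, (fun (g : G) j => g.1 (feat (sep j))) k j ≠
      (fun (g : G) j => g.1 (feat (sep j))) k' j := by
    intro k k' hk
    obtain ⟨_, ⟨j, rfl⟩, hj⟩ := hsep k k.2 k' k'.2 fun h => hk (Subtype.ext h)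
    exact ⟨j, hj⟩
  have h := sum_integral_leader_le (ι := G) hd (by simpa using hcard) hB hρ
    (ℓ := fun i k => M.r (σ i) * member feat k.1 (σ i).1)
    (fun i k => reward_mul_member_mem_Icc M feat _ _ _)
    (m := fun t η => leader M O sep (fun i : Fin t => σ i) η)
    (fun t => measurable_to_countable' fun k =>
      measurable_prodMk_left (measurableSet_leader_eq M O sep k))
    (fun t η k => by
      simpa only [Finset.sum_range] using leader_le M O sep (fun i : Fin t => σ i) η k) T g
  rw [Finset.sum_range, Finset.sum_range, Fintype.card_coe] at h
  simp only [hσ', integral_const_mul] at h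
  refine le_of_eq_of_le (Finset.sum_congr rfl fun t _ => ?_) h
  have e : observed (before ω t) = fun i : Fin t => σ i := by
    funext i
    exact (hσ' ⟨i, i.2.trans t.2⟩).symm
  rw [e, coverProb]

/-! ### The choice of the parameters -/

/-- Since ρ²T√d = log N, the term √d log N / ρ equals Tdρ, so the whole bound is (1/2 + 8) C T d ρ.
-/
lemma noiseRate_bound {N d T : ℕ} (hN : 2 ≤ N) (hd : 0 < d) (hT : 0 < T) {C γ : ℝ}
    (hγ : 0 < γ)
    (h : 300 * (C ^ 2 * (d : ℝ) ^ (3 / 2 : ℝ) * Real.log N / γ ^ 2) ≤ T) :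
    0 < noiseRate N d T ∧ C * (T * (d * (noiseRate N d T / 2)) +
      8 * (√(d : ℝ) * Real.log N / noiseRate N d T)) ≤ γ * T / 2 := by
  have hT' : (0 : ℝ) < T := by exact_mod_cast hT
  have hd' : (0 : ℝ) < d := by exact_mod_cast hd
  have hl : 0 < Real.log N := Real.log_pos (by exact_mod_cast hN)
  set q : ℝ := √(d : ℝ) with hq
  have hq0 : 0 < q := Real.sqrt_pos.2 hd'
  have hqd : (d : ℝ) = q ^ 2 := (Real.sq_sqrt hd'.le).symm
  have h32 : (d : ℝ) ^ (3 / 2 : ℝ) = q ^ 3 := by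
    rw [hq, Real.sqrt_eq_rpow, ← Real.rpow_natCast, ← Real.rpow_mul hd'.le]
    norm_num
  set ρ : ℝ := noiseRate N d T with hρ
  have hρ0 : 0 < ρ := Real.sqrt_pos.2 (by positivity)
  have hρ2 : ρ ^ 2 * (T * q) = Real.log N := by
    rw [hρ, noiseRate, ← hq, Real.sq_sqrt (by positivity)]
    field_simp
  refine ⟨hρ0, ?_⟩
  have e : q * Real.log N / ρ = T * (q ^ 2 * ρ) := by
    rw [← hρ2]; field_simp
  rw [e, hqd]
  rw [h32, mul_div_assoc', div_le_iff₀ (by positivity)] at h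
  -- The requirement 8.5 Cdρ ≤ γ/2 reads 17 Cdρ ≤ γ, and 17² = 289 ≤ 300.
  have hsq : (17 * (C * (q ^ 2 * ρ))) ^ 2 ≤ γ ^ 2 := by
    rw [← hρ2] at h
    have h' : T * (300 * (C * (q ^ 2 * ρ)) ^ 2) ≤ T * γ ^ 2 := by
      calc _ = _ := by ring
        _ ≤ _ := h
    have := le_of_mul_le_mul_left h' hT'
    nlinarith [sq_nonneg (C * (q ^ 2 * ρ))]
  have h17 : 17 * (C * (q ^ 2 * ρ)) ≤ γ := le_of_sq_le_sq hsq hγ.le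
  nlinarith

/-- Union bound over N groups at deviation γT/(2C): the Azuma exponent is γ²T/(32C²), so the
constant 32 would already suffice. -/
lemma card_mul_exp_le {N T : ℕ} (hN : 0 < N) (hT : 0 < T) {C γ δ : ℝ} (hC : 0 < C) (hγ : 0 < γ)
    (hδ : 0 < δ) (h : 300 * (C ^ 2 / γ ^ 2 * Real.log (N / δ)) ≤ T)
    (hlog : 0 ≤ Real.log (N / δ)) :
    N * Real.exp (-((γ * T / (2 * C)) ^ 2 / (8 * T))) ≤ δ := by
  have hT' : (0 : ℝ) < T := by exact_mod_cast hT
  have hN' : (0 : ℝ) < N := by exact_mod_cast hN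
  have e : (γ * T / (2 * C)) ^ 2 / (8 * T) = γ ^ 2 / C ^ 2 * T / 32 := by
    field_simp
    norm_num
  have h₁ : Real.log (N / δ) ≤ γ ^ 2 / C ^ 2 * T / 32 := by
    have h₂ := mul_le_mul_of_nonneg_left h (by positivity : 0 ≤ γ ^ 2 / C ^ 2)
    have h₃ : γ ^ 2 / C ^ 2 * (300 * (C ^ 2 / γ ^ 2 * Real.log (N / δ))) =
        300 * Real.log (N / δ) := by
      field_simp
    linarith
  rw [e]
  calc N * Real.exp (-(γ ^ 2 / C ^ 2 * T / 32)) ≤ N * Real.exp (-Real.log (N / δ)) := by gcongr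
    _ = δ := by
      rw [Real.exp_neg, Real.exp_log (by positivity)]
      field_simp

/-! ### High-probability regret against every group -/

section Game

variable {S : Type u} {A : Type v} {Q : Type w} {X : Type x} {W : Type y}
variable [MeasurableSpace S] [MeasurableSpace A] [MeasurableSpace Q] [MeasurableSpace W]
variable {d : ℕ} {feat : S → X} {G : Finset (X → Bool)}

/-- With high probability the regulator has low regret against every group. -/
theorem exists_event_groupCost_le (M : MDP S A) (Pol : PolicyClass S A Q) (O : OptOracle feat G)
    (sep : Fin d → S) (L : Learner W S A Q d) (hcard : 2 ≤ G.card)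
    (hG : ∀ g ∈ G, Measurable fun s => g (feat s)) (hsep : IsSeparator feat G (Set.range sep))
    (hd : 0 < d) {C γ δ : ℝ} (hC : 0 < C) (hγ : 0 < γ) (hδ : 0 < δ) (hδ1 : δ < 1) {T : ℕ}
    (hT : 0 < T)
    (h₁ : 300 * (C ^ 2 * (d : ℝ) ^ (3 / 2 : ℝ) * Real.log G.card / γ ^ 2) ≤ T)
    (h₂ : 300 * (C ^ 2 / γ ^ 2 * Real.log (G.card / δ)) ≤ T) :
    ∃ E : Set (History W S A d T),
      ENNReal.ofReal (1 - δ) ≤ historyLaw M Pol L (noiseRate G.card d T) T E ∧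
      ∀ ω ∈ E, ∀ g : G, C * ∑ t, (groupCost M Pol feat (selected M O sep ω t).1 (played L ω t) -
        groupCost M Pol feat g.1 (played L ω t)) ≤ γ * T := by
  obtain ⟨hρ, hbound⟩ := noiseRate_bound hcard hd hT hγ h₁
  set ρ := noiseRate G.card d T
  have hT' : (0 : ℝ) < T := by exact_mod_cast hT
  -- After scaling by C, the martingale uses half of the budget γT; the perturbed leader uses the
  -- other half.
  set ε : ℝ := γ * T / (2 * C) with hε
  have hcard' : (2 : ℝ) ≤ G.card := by exact_mod_cast hcard
  have hlog : 0 ≤ Real.log (G.card / δ) := by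
    refine Real.log_nonneg ((one_le_div hδ).2 ?_)
    linarith
  have hP := isProbabilityMeasure_historyLaw M Pol L hρ T
  set Z : G → History W S A d T → ℝ := fun g ω =>
    ∑ t : Fin T, increment M Pol O sep L ρ g t (before ω t) (ω.2 t) with hZ
  have hZm : ∀ g, Measurable (Z g) := fun g =>
    measurable_sum_increments (fun t => measurable_increment M Pol O sep L ρ hG hρ g t) T
  set bad : Set (History W S A d T) := ⋃ g, {ω | ε ≤ Z g ω} with hbad
  have hbadm : MeasurableSet bad :=
    MeasurableSet.iUnion fun g => measurableSet_le measurable_const (hZm g)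
  have hbadle : historyLaw M Pol L ρ T bad ≤ ENNReal.ofReal δ := by
    refine (measure_iUnion_fintype_le _ _).trans ?_
    refine (Finset.sum_le_sum fun g _ => historyLaw_sum_increments_ge_le M Pol L hρ
      (fun t => measurable_increment M Pol O sep L ρ hG hρ g t)
      (fun t => increment_mem_Icc M Pol O sep L ρ hG hρ g t)
      (fun t => integral_increment M Pol O sep L ρ hG hρ g t) hT (by positivity)).trans ?_
    rw [Finset.sum_const, Finset.card_univ, Fintype.card_coe, nsmul_eq_mul,
      ← ENNReal.ofReal_natCast, ← ENNReal.ofReal_mul (by positivity)]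
    exact ENNReal.ofReal_le_ofReal (card_mul_exp_le (by omega) hT hC hγ hδ h₂ hlog)
  refine ⟨badᶜ, ?_, fun ω hω g => ?_⟩
  · rw [prob_compl_eq_one_sub hbadm, ENNReal.ofReal_sub _ hδ.le, ENNReal.ofReal_one]
    exact tsub_le_tsub_left hbadle 1
  · have hlt : Z g ω < ε := by
      by_contra hc
      exact hω (Set.mem_iUnion.2 ⟨g, not_lt.1 hc⟩)
    have hpath := sum_reward_mul_coverProb_le M O sep hcard hsep hρ hd hT ω g
    have hsum : Z g ω = ∑ t, (groupCost M Pol feat (selected M O sep ω t).1 (played L ω t) -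
        groupCost M Pol feat g.1 (played L ω t)) -
        ∑ t, M.r (ω.2 t).2 * coverProb M O sep ρ (observed (before ω t)) (ω.2 t).2.1 +
        ∑ t, M.r (ω.2 t).2 * member feat g.1 (ω.2 t).2.1 := by
      rw [← Finset.sum_sub_distrib, ← Finset.sum_add_distrib]
      refine Finset.sum_congr rfl fun t _ => ?_
      have e : selected M O sep ω t = leader M O sep (observed (before ω t)) (ω.2 t).1 := rfl
      rw [increment, e, played]
      ring
    have hCε : C * ε = γ * T / 2 := by
      rw [hε]; field_simp
    have := mul_le_mul_of_nonneg_left (show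
      ∑ t, (groupCost M Pol feat (selected M O sep ω t).1 (played L ω t) -
        groupCost M Pol feat g.1 (played L ω t)) ≤ ε +
        (T * (d * (ρ / 2)) + 8 * (√(d : ℝ) * Real.log G.card / ρ)) by linarith) hC.le
    rw [mul_add] at this
    linarith

end Game

end ContextualFTPL

end

theorem mainTheorem5 :
    ∃ K : ℝ, 0 < K ∧
      ∀ (S : Type*) (A : Type*) (Q : Type*) (X : Type*) (W : Type*)
        [MeasurableSpace S] [MeasurableSpace A] [MeasurableSpace Q] [MeasurableSpace W]
        (M : ContextualFTPL.MDP S A) (Pol : ContextualFTPL.PolicyClass S A Q)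
        (feat : S → X) (G : Finset (X → Bool))
        (_ : 2 ≤ G.card) (_ : ∀ g ∈ G, Measurable fun s => g (feat s))
        (d : ℕ) (sep : Fin d → S) (_ : Function.Injective sep)
        (_ : ContextualFTPL.IsSeparator feat G (Set.range sep))
        (O : ContextualFTPL.OptOracle feat G) (L : ContextualFTPL.Learner W S A Q d)
        (α C γ δ : ℝ) (_ : 0 < C) (_ : 0 < γ) (_ : 0 < δ) (_ : δ < 1) (T : ℕ)
        (_ : K * (C ^ 2 * (d : ℝ) ^ (3 / 2 : ℝ) * Real.log G.card / γ ^ 2 +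
          C ^ 2 / γ ^ 2 * Real.log (G.card / δ)) ≤ T),
        ENNReal.ofReal (1 - δ) ≤
          ContextualFTPL.historyLaw M Pol L (ContextualFTPL.noiseRate G.card d T) T
            {ω |
              -- `λ_t` is `C e_{g_t}` or, if `D_t` meets the constraint of `g_t`, it is `0`
              ContextualFTPL.regret M Pol feat G α (ContextualFTPL.played L ω)
                  (fun t => ContextualFTPL.violatedGroup M Pol feat G α C
                    (ContextualFTPL.played L ω t) (ContextualFTPL.selected M O sep ω t))
                  (ContextualFTPL.weights G C) ≤ γ * T ∧
              -- `λ_t` is always `C e_{g_t}`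
              ContextualFTPL.regret M Pol feat G α (ContextualFTPL.played L ω)
                  (fun t => ContextualFTPL.oneGroup G C (ContextualFTPL.selected M O sep ω t))
                  (ContextualFTPL.fullWeights G C) ≤ γ * T ∧
              ((∃ g ∈ G, ∑ t, ContextualFTPL.groupValue M Pol feat g
                  (ContextualFTPL.played L ω t) ≤ T * α) →
                ContextualFTPL.regret M Pol feat G α (ContextualFTPL.played L ω)
                  (fun t => ContextualFTPL.oneGroup G C (ContextualFTPL.selected M O sep ω t))
                  (ContextualFTPL.weights G C) ≤ γ * T)} := by
  refine ⟨300, by norm_num, ?_⟩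
  intro S A Q X W _ _ _ _ M Pol feat G hcard hG d sep _ hsep O L α C γ δ hC hγ hδ hδ1 T hT
  have hcard' : (2 : ℝ) ≤ G.card := by exact_mod_cast hcard
  have hlog : 0 < Real.log G.card := Real.log_pos (by linarith)
  have hlogδ : 0 < Real.log (G.card / δ) :=
    Real.log_pos ((one_lt_div hδ).2 (by linarith))
  have ha : 0 ≤ C ^ 2 * (d : ℝ) ^ (3 / 2 : ℝ) * Real.log G.card / γ ^ 2 := by positivity
  have hb : 0 < C ^ 2 / γ ^ 2 * Real.log (G.card / δ) := by positivity
  have hT0 : 0 < T := by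
    have : (0 : ℝ) < T := by linarith
    exact_mod_cast this
  -- Two distinct groups must be separated somewhere, so the separator is nonempty.
  have hd : 0 < d := by
    obtain ⟨g, hg, g', hg', hne⟩ := Finset.one_lt_card.1 (show 1 < G.card by omega)
    obtain ⟨_, ⟨j, _⟩, _⟩ := hsep g hg g' hg' hne
    exact j.pos
  have : Nonempty G := (Finset.card_pos.1 (show 0 < G.card by omega)).to_subtype
  obtain ⟨E, hE, hreg⟩ := ContextualFTPL.exists_event_groupCost_le M Pol O sep L hcard hG hsep hd
    hC hγ hδ hδ1 hT0 (by linarith) (by linarith)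
  -- Monotonicity of the outer measure suffices, so measurability of the regret event is never
  -- needed.
  refine hE.trans (MeasureTheory.measure_mono fun ω hω => ?_)
  have hD : ∀ t, MeasureTheory.IsProbabilityMeasure (ContextualFTPL.played L ω t) := fun t =>
    (L.play_markov t).isProbabilityMeasure _
  exact ContextualFTPL.regret_le_of_groupCost M Pol hG hC (by positivity) _ hD _ (hreg ω hω)
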